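/- Let $V$ be the vertex set of a Platonic polyhedron in $\mathbb{R}^3$ centred at the origin, let $\widetilde{\mathcal R}\subset O(3)$ be its full symmetry group (reflections included) and $\mathcal R=\widetilde{\mathcal R}\cap SO(3)$ its rotation group, $N=|\mathcal R|\in\{12,24,60\}$. Let $\Gamma=\{x\in\mathbb{R}^3 : Rx=x \text{ for some } R\in\mathcal R\setminus\{I\}\}$ be the union of the rotation axes and $\mathcal P=\Gamma\cap\mathbb S^2$ the set of poles; the order $\mathfrak o_p$ of $p\in\mathcal P$ is the number of $R\in\mathcal R$ with $Rp=p$. The planes of the reflections in $\widetilde{\mathcal R}$ divide $\mathbb S^2$ into $2N$ open spherical triangles; let $\tau$ be any of them. Let $\alpha\in[1,2)$, $m_0\ge 0$, $T>0$, and let $M\ge 1$ be an integer. For a $T$-periodic $H^1$ loop $u:\mathbb{R}\to\mathbb{R}^3$ (the motion of the generating particle, the $N$ satellites of unit mass being $Ru$, $R\in\mathcal R$, with a central mass $m_0$ fixed at the origin) put $$\mathcal A^\alpha(u)=N\int_0^T\Big(\frac{|\dot u|^2}{2}+\frac{m_0}{|u|^\alpha}+\frac12\sum_{R\in\mathcal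 R\setminus\{I\}}\frac{1}{|(R-I)u|^\alpha}\Big)dt\in[0,+\infty].$$ Fix a non-trivial free-homotopy class of loops in $\mathbb{R}^3\setminus\Gamma$, and let $\mathcal K$ be the set of $T$-periodic $H^1$ loops $u$ with values in $\mathbb{R}^3\setminus\Gamma$ that belong to this class and satisfy $u(t+T/M)=Ru(t)$ for all $t\in\mathbb{R}$, for some $R\in\mathcal R$. Let $\overline{\mathcal K}$ be the closure of $\mathcal K$ in the $H^1$ topology. If $u\in\overline{\mathcal K}$ has (at least) $M$ total collisions per period, that is, $u(t)=0$ for at least $M$ times $t\in[0,T)$, where $M$ is the same integer as in the symmetry condition defining $\mathcal K$, then $$\mathcal A^\alpha(u)\ \ge\ \frac{2+\alpha}{2-\alpha}\,\frac N2\,\big(\tilde U_{\alpha,0}+2m_0\big)^{\frac{2}{2+\alpha}}\Big(\frac{M\pi}{\alpha}\Big)^{\frac{2\alpha}{2+\alpha}}T^{\frac{2-\alpha}{2+\alpha}},$$ where $$\tilde U_{\alpha,0}=\frac1{2^{\alpha+1}}\sum_{p\in\mathcal P}\frac{k_{\alpha,p}}{\max_{x\in\overline\tau}|x\times p|^\alpha},\qquad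 k_{\alpha,p}=\sum_{j=1}^{\mathfrak o_p-1}\frac1{\sin^\alpha(j\pi/\mathfrak o_p)}.$$ -/

import Mathlib

open MeasureTheory Set
open scoped ENNReal

noncomputable section

namespace PlatonicBody

/-- Euclidean three-space. -/
abbrev R3 : Type := EuclideanSpace ℝ (Fin 3)

/-! The Platonic polyhedra centred at the origin, given by their sets of vertices.
Coordinate indices are taken modulo 3, so each condition is cyclically symmetric. -/

/-- The tetrahedron `(1,1,1), (1,-1,-1), (-1,1,-1), (-1,-1,1)`. -/
def tetrahedron : Set R3 := {x | (∀ i, |x i| = 1) ∧ x 0 * x 1 * x 2 = 1}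

/-- The cube `(±1,±1,±1)`. -/
def cube : Set R3 := {x | ∀ i, |x i| = 1}

/-- The octahedron with vertices plus or minus the standard basis vectors. -/
def octahedron : Set R3 := {x | ∃ i : Fin 3, |x i| = 1 ∧ x (i + 1) = 0 ∧ x (i + 2) = 0}

/-- The icosahedron: cyclic permutations of `(0, ±1, ±φ)`, with `φ` the golden ratio. -/
def icosahedron : Set R3 :=
  {x | ∃ i : Fin 3, x i = 0 ∧ |x (i + 1)| = 1 ∧ |x (i + 2)| = Real.goldenRatio}

/-- The dodecahedron: `(±1,±1,±1)` and the cyclic permutations of `(0, ±φ⁻¹, ±φ)`. -/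
def dodecahedron : Set R3 :=
  cube ∪ {x | ∃ i : Fin 3, x i = 0 ∧ |x (i + 1)| = Real.goldenRatio⁻¹ ∧
    |x (i + 2)| = Real.goldenRatio}

/-- `V` is the vertex set of a Platonic polyhedron centred at the origin (any size and position). -/
def IsPlatonic (V : Set R3) : Prop :=
  ∃ P ∈ ({tetrahedron, cube, octahedron, icosahedron, dodecahedron} : Set (Set R3)),
    ∃ r : ℝ, 0 < r ∧ ∃ g : R3 ≃ₗᵢ[ℝ] R3, V = (fun x => r • g x) '' P

/-- The full symmetry group (reflections included) of the polyhedron with vertex set `V`. -/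
def fullGroup (V : Set R3) : Subgroup (R3 ≃ₗᵢ[ℝ] R3) where
  carrier := {g | g '' V = V}
  one_mem' := by simp
  mul_mem' := by
    intro a b ha hb
    simp only [Set.mem_ofPred_eq] at ha hb ⊢
    rw [LinearIsometryEquiv.coe_mul, image_comp, hb, ha]
  inv_mem' := by
    intro a ha
    simp only [Set.mem_ofPred_eq] at ha ⊢
    conv_lhs => rw [← ha]
    rw [← image_comp, ← LinearIsometryEquiv.coe_mul, inv_mul_cancel]
    simp

/-- The rotation group of the polyhedron with vertex set `V`. -/
def rotationGroup (V : Set R3) : Subgroup (R3 ≃ₗᵢ[ℝ] R3) where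
  carrier := {g | g ∈ fullGroup V ∧ LinearMap.det (g.toLinearEquiv : R3 →ₗ[ℝ] R3) = 1}
  one_mem' := ⟨one_mem _, LinearMap.det_id⟩
  mul_mem' := by
    rintro a b ⟨ha, ha'⟩ ⟨hb, hb'⟩
    refine ⟨mul_mem ha hb, ?_⟩
    have h : ((a * b).toLinearEquiv : R3 →ₗ[ℝ] R3)
        = (a.toLinearEquiv : R3 →ₗ[ℝ] R3) ∘ₗ (b.toLinearEquiv : R3 →ₗ[ℝ] R3) := rfl
    rw [h, LinearMap.det_comp, ha', hb', one_mul]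
  inv_mem' := by
    rintro a ⟨ha, ha'⟩
    refine ⟨inv_mem ha, ?_⟩
    have h : ((a⁻¹).toLinearEquiv : R3 →ₗ[ℝ] R3) ∘ₗ (a.toLinearEquiv : R3 →ₗ[ℝ] R3)
        = LinearMap.id := by
      ext1 x
      exact a.symm_apply_apply x
    have h2 := congrArg LinearMap.det h
    rw [LinearMap.det_comp, ha', mul_one, LinearMap.det_id] at h2
    exact h2

/-- The collision set `Γ`: the union of the axes of the non-identity elements of `G`. -/
def collisionSet (G : Subgroup (R3 ≃ₗᵢ[ℝ] R3)) : Set R3 :=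
  {x | ∃ R ∈ G, R ≠ 1 ∧ R x = x}

/-- The poles: the points of the unit sphere on the rotation axes. -/
def poles (G : Subgroup (R3 ≃ₗᵢ[ℝ] R3)) : Set R3 :=
  collisionSet G ∩ Metric.sphere 0 1

/-- The order of a pole: the number of elements of `G` that fix it. -/
def poleOrder (G : Subgroup (R3 ≃ₗᵢ[ℝ] R3)) (p : R3) : ℕ :=
  Nat.card {R : R3 ≃ₗᵢ[ℝ] R3 // R ∈ G ∧ R p = p}

/-- The union of the mirror planes of the plane reflections that belong to `G`. -/
def mirrors (G : Subgroup (R3 ≃ₗᵢ[ℝ] R3)) : Set R3 :=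
  {x | ∃ n : R3, n ≠ 0 ∧ (Submodule.span ℝ {n})ᗮ.reflection ∈ G ∧ inner ℝ n x = 0}

/-- The open triangles of the tessellation of the unit sphere that is cut out by the mirror
planes of `G`. -/
def tessellation (G : Subgroup (R3 ≃ₗᵢ[ℝ] R3)) : Set (Set R3) :=
  {τ | ∃ x ∈ Metric.sphere (0 : R3) 1 \ mirrors G,
    τ = connectedComponentIn (Metric.sphere (0 : R3) 1 \ mirrors G) x}

/-- The Euclidean norm of the cross product of `x` and `p`. -/
def crossNorm (x p : R3) : ℝ :=
  ‖WithLp.toLp 2 (crossProduct (WithLp.ofLp x) (WithLp.ofLp p))‖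

/-- `k_{α,p} = ∑_{j=1}^{o_p-1} 1 / sin^α (jπ/o_p)`. -/
def poleCoeff (G : Subgroup (R3 ≃ₗᵢ[ℝ] R3)) (α : ℝ) (p : R3) : ℝ :=
  ∑ j ∈ Finset.Ico 1 (poleOrder G p), 1 / Real.sin (j * Real.pi / poleOrder G p) ^ α

/-- `Ũ_{α,0} = 2^{-(α+1)} ∑_p k_{α,p} / max_{x ∈ closure τ} |x × p|^α`, the sum being over the
(finitely many) poles. -/
def potentialBound (G : Subgroup (R3 ≃ₗᵢ[ℝ] R3)) (τ : Set R3) (α : ℝ) : ℝ :=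
  1 / 2 ^ (α + 1) *
    ∑ᶠ p : poles G, poleCoeff G α p / sSup ((fun x => crossNorm x p ^ α) '' closure τ)

/-- `T`-periodic loops of class `H¹`: absolutely continuous with derivative in `L²(0,T)`. -/
def IsH1Loop (T : ℝ) (u : ℝ → R3) : Prop :=
  Function.Periodic u T ∧
    ∃ v : ℝ → R3, MemLp v 2 (volume.restrict (Ioc 0 T)) ∧
      ∀ t ∈ Icc 0 T, u t = u 0 + ∫ s in (0 : ℝ)..t, v s

/-- The squared `H¹(0,T)` distance of two loops. -/
def h1DistSq (T : ℝ) (u w : ℝ → R3) : ℝ≥0∞ :=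
  ∫⁻ t in Ioc 0 T, (‖u t - w t‖ₑ ^ 2 + ‖deriv u t - deriv w t‖ₑ ^ 2)

/-- The closure of a set of loops in the space of `T`-periodic `H¹` loops. -/
def h1Closure (T : ℝ) (K : Set (ℝ → R3)) : Set (ℝ → R3) :=
  {u | IsH1Loop T u ∧ ∀ ε > 0, ∃ w ∈ K, h1DistSq T u w < ε}

/-- The set of `H¹` loops that avoid `Γ`, lie in the free-homotopy class of the loop `c` in the
complement of `Γ`, and satisfy `u (t + T / M) = R (u t)` for some `R ∈ G` and all `t`. -/
def cone (G : Subgroup (R3 ≃ₗᵢ[ℝ] R3)) (T : ℝ) (M : ℕ)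
    (c : C(AddCircle T, {x : R3 // x ∉ collisionSet G})) : Set (ℝ → R3) :=
  {u | IsH1Loop T u ∧
    (∃ f : C(AddCircle T, {x : R3 // x ∉ collisionSet G}),
      (∀ t : ℝ, (f (t : AddCircle T) : R3) = u t) ∧ f.Homotopic c) ∧
    ∃ R ∈ G, ∀ t : ℝ, u (t + T / M) = R (u t)}

/-- The action of the symmetric motion generated by `u`,
`N ∫₀ᵀ (|u'|²/2 + m₀/|u|^α + (1/2) ∑_{R ≠ 1} 1/|(R - 1)u|^α) dt` with `N = |G|`, as an extended
nonnegative real. -/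
def action (G : Subgroup (R3 ≃ₗᵢ[ℝ] R3)) (α m₀ T : ℝ) (u : ℝ → R3) : ℝ≥0∞ :=
  Nat.card G * ∫⁻ t in Ioc 0 T,
    (‖deriv u t‖ₑ ^ 2 / 2 + ENNReal.ofReal m₀ / ‖u t‖ₑ ^ α +
      1 / 2 * ∑' R : {R : R3 ≃ₗᵢ[ℝ] R3 // R ∈ G ∧ R ≠ 1}, 1 / ‖R.1 (u t) - u t‖ₑ ^ α)

/-- The times in one period at which all particles collide at the origin. -/
def totalCollisions (T : ℝ) (u : ℝ → R3) : Set ℝ := {t ∈ Ico 0 T | u t = 0}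

end PlatonicBody

end

namespace PlatonicBody

open Filter Topology

/-! The many-body action is bounded below by that of a one-centre problem, which is then cut at
collision times.

Potential: a rotation by angle 2jπ/o about a pole p moves x by 2 sin(jπ/o)|x × p|, and a
non-identity rotation fixes at most two poles, p and -p. Summing over stabilisers of poles therefore
counts each rotation at most twice (`sum_poles_le`). The full group moves x/|x| into the closed
triangle, where |x × p| is at most its maximum, so the interaction term is at least (Ũ/2)/|x|^α
(`potential_ge`). The Lagrangian is thus at least |u'|²/2 + μ/|u|^α with μ = m₀ + Ũ/2.

One arc: let u vanish at both ends of an interval of length S, and let R be its maximal radius.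
Completing the square gives |v|²/2 + μρ^(-α) ≥ μR^(-α) + √(2μ) √(ρ^(-α) - R^(-α)) |v|. For α ≥ 1 the
inner difference is at least ρ^(-α)(1 - (ρ/R)^(2-α)), whose square root has an explicit primitive.
The path covers the radii from 0 to R and back, and a weighted AM-GM inequality eliminates R
(`IsACPath.ejectionAction_le_lintegral`).

Symmetry: |u(t + T/M)| = |u(t)| survives the closure, so a collision recurs at steps of T/M and a
period splits into M arcs of length T/M. -/

/-! ### Absolutely continuous paths -/

/-- A path that is the integral of its derivative. -/
structure IsACPath {E : Type*} [NormedAddCommGroup E] [NormedSpace ℝ E] (u : ℝ → E) : Prop where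
  intervalIntegrable : ∀ a b, IntervalIntegrable (deriv u) volume a b
  integral_deriv : ∀ a b, ∫ t in a..b, deriv u t = u b - u a

theorem absolutelyContinuousOnInterval_of_dist_le {X Y : Type*} [PseudoMetricSpace X]
    [PseudoMetricSpace Y] {f : ℝ → X} {g : ℝ → Y} {a b C : ℝ}
    (hg : AbsolutelyContinuousOnInterval g a b)
    (h : ∀ s t, dist (f s) (f t) ≤ C * dist (g s) (g t)) :
    AbsolutelyContinuousOnInterval f a b := by
  unfold AbsolutelyContinuousOnInterval at hg ⊢
  refine squeeze_zero (fun _ => Finset.sum_nonneg fun _ _ => dist_nonneg) (fun E => ?_)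
    (by simpa using hg.const_mul C)
  rw [Finset.mul_sum]
  exact Finset.sum_le_sum fun i _ => h _ _

section Path

variable {E : Type*} [NormedAddCommGroup E] [InnerProductSpace ℝ E] {u : ℝ → E}

theorem IsACPath.ae_hasDerivAt [CompleteSpace E] (hu : IsACPath u) : ∀ᵐ t, HasDerivAt u (deriv u t) t := by
  have hl : LocallyIntegrable (deriv u) volume := by
    intro x
    refine ⟨Ioc (x - 1) (x + 1), Ioc_mem_nhds (by linarith) (by linarith), ?_⟩
    exact (hu.intervalIntegrable (x - 1) (x + 1)).1
  filter_upwards [_root_.LocallyIntegrable.ae_hasDerivAt_integral hl] with t ht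
  have := (ht 0).add_const (u 0)
  refine this.congr_of_eventuallyEq (Eventually.of_forall fun s => ?_)
  simp [hu.integral_deriv]

theorem IsACPath.norm_sub_le (hu : IsACPath u) (s t : ℝ) :
    ‖u t - u s‖ ≤ |∫ r in s..t, ‖deriv u r‖| := by
  rw [← hu.integral_deriv s t]
  exact intervalIntegral.norm_integral_le_abs_integral_norm

theorem IsACPath.continuous (hu : IsACPath u) : Continuous u := by
  have : u = fun t => (∫ s in (0 : ℝ)..t, deriv u s) + u 0 := by
    ext t; simp [hu.integral_deriv]
  rw [this]
  exact (intervalIntegral.continuous_primitive hu.intervalIntegrable 0).add continuous_const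

/-- Change of variables s = ‖u t‖, with the radial speed bounded by the speed. The bound `C`
dominates increments of the composed primitive by arc length; this makes it absolutely continuous,
so its derivative need only be estimated almost everywhere. -/
theorem IsACPath.integral_comp_norm_le [CompleteSpace E] (hu : IsACPath u) {ψ : ℝ → ℝ} (hψ : Continuous ψ)
    (hψ0 : ∀ s, 0 ≤ ψ s) {C : ℝ} (hC : ∀ s, ψ s ≤ C) {a b : ℝ} (hab : a ≤ b) :
    |∫ s in ‖u a‖..‖u b‖, ψ s| ≤ ∫ t in a..b, ψ ‖u t‖ * ‖deriv u t‖ := by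
  have hii : ∀ x y, IntervalIntegrable ψ volume x y := fun x y => hψ.intervalIntegrable x y
  set h : ℝ → ℝ := fun t => ∫ s in (0 : ℝ)..‖u t‖, ψ s with hh
  have hdiff : ∀ s t, h t - h s = ∫ r in ‖u s‖..‖u t‖, ψ r := fun s t =>
    intervalIntegral.integral_interval_sub_left (hii _ _) (hii _ _)
  have hn : ∀ x y, IntervalIntegrable (fun t => ‖deriv u t‖) volume x y :=
    fun x y => (hu.intervalIntegrable x y).norm
  have hac : AbsolutelyContinuousOnInterval h a b := by
    refine absolutelyContinuousOnInterval_of_dist_le (C := C)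
      (IntervalIntegrable.absolutelyContinuousOnInterval_intervalIntegral (hn a b) (c := a)
        (by simp)) fun s t => ?_
    rw [dist_comm, dist_comm (∫ t in a..s, ‖deriv u t‖), Real.dist_eq, Real.dist_eq, hdiff,
      intervalIntegral.integral_interval_sub_left (hn _ _) (hn _ _)]
    have h1 : ‖∫ r in ‖u s‖..‖u t‖, ψ r‖ ≤ C * |‖u t‖ - ‖u s‖| :=
      intervalIntegral.norm_integral_le_of_norm_le_const fun x _ => by
        rw [Real.norm_of_nonneg (hψ0 x)]; exact hC x
    have hC0 : 0 ≤ C := (hψ0 0).trans (hC 0)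
    exact h1.trans (mul_le_mul_of_nonneg_left
      ((abs_norm_sub_norm_le _ _).trans (hu.norm_sub_le s t)) hC0)
  have hder : ∀ᵐ t, t ∈ uIcc a b → ‖deriv h t‖ ≤ ψ ‖u t‖ * ‖deriv u t‖ := by
    filter_upwards [hu.ae_hasDerivAt] with t ht _
    by_cases h0 : u t = 0
    -- The norm is not differentiable at the origin, but `h` has a minimum there, so its derivative
    -- is zero.
    · have hmin : IsLocalMin h t := Eventually.of_forall fun s => by
        have := hdiff t s
        have h2 : 0 ≤ ∫ r in ‖u t‖..‖u s‖, ψ r :=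
          intervalIntegral.integral_nonneg (by simp [h0]) fun x _ => hψ0 x
        linarith
      rw [hmin.deriv_eq_zero, norm_zero]
      exact mul_nonneg (hψ0 _) (norm_nonneg _)
    · have h1 : HasFDerivAt (fun x : E => ‖x‖) (fderiv ℝ (fun x : E => ‖x‖) (u t)) (u t) :=
        (differentiableAt_id.norm ℝ h0).hasFDerivAt
      have h2 := h1.comp_hasDerivAt t ht
      have h3 : HasDerivAt (fun y => ∫ s in (0 : ℝ)..y, ψ s) (ψ ‖u t‖) ‖u t‖ :=
        intervalIntegral.integral_hasDerivAt_right (hii _ _)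
          (hψ.stronglyMeasurableAtFilter _ _) hψ.continuousAt
      have h4 := h3.comp t h2
      rw [show h = (fun y => ∫ s in (0 : ℝ)..y, ψ s) ∘ (fun x : E => ‖x‖) ∘ u from rfl, h4.deriv,
        norm_mul, Real.norm_of_nonneg (hψ0 _)]
      refine mul_le_mul_of_nonneg_left ?_ (hψ0 _)
      refine (ContinuousLinearMap.le_opNorm _ _).trans ?_
      have := norm_fderiv_le_of_lipschitz ℝ (lipschitzWith_one_norm (E := E)) (x₀ := u t)
      exact mul_le_of_le_one_left (norm_nonneg _) (by simpa using this)
  have hint : IntervalIntegrable (fun t => ψ ‖u t‖ * ‖deriv u t‖) volume a b :=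
    (hn a b).continuousOn_mul (hψ.comp hu.continuous.norm).continuousOn
  rw [← hdiff, ← hac.integral_deriv_eq_sub, ← Real.norm_eq_abs]
  refine intervalIntegral.norm_integral_le_of_norm_le hab ?_ hint
  filter_upwards [hder] with t ht hm
  exact ht (by rw [uIcc_of_le hab]; exact Ioc_subset_Icc_self hm)

end Path

/-! ### Periodic loops of class `H¹` -/

theorem IsH1Loop.isACPath {T : ℝ} (hT : 0 < T) {u : ℝ → R3} (hu : IsH1Loop T u) :
    IsACPath u := by
  obtain ⟨hper, v, hv, huv⟩ := hu
  have hvi : IntervalIntegrable v volume 0 T := by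
    rw [intervalIntegrable_iff_integrableOn_Ioc_of_le hT.le]
    exact hv.integrable one_le_two
  have hdv : ∀ᵐ t, t ∈ Ioo 0 T → deriv u t = v t := by
    filter_upwards [hvi.ae_hasDerivAt_integral] with t ht hm
    have hI : t ∈ uIcc 0 T := by rw [uIcc_of_le hT.le]; exact Ioo_subset_Icc_self hm
    have h1 := (ht hI 0 (by simp)).const_add (u 0)
    refine (h1.congr_of_eventuallyEq ?_).deriv
    filter_upwards [Ioo_mem_nhds hm.1 hm.2] with s hs
    exact huv s (Ioo_subset_Icc_self hs)
  have hdv' : ∀ᵐ t, t ∈ Ioc 0 T → deriv u t = v t := by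
    filter_upwards [hdv, compl_mem_ae_iff.mpr (measure_singleton (μ := volume) T)] with t ht hne hm
    exact ht ⟨hm.1, lt_of_le_of_ne hm.2 hne⟩
  have hper' : Function.Periodic (deriv u) T := by
    intro t
    have : (fun s => u (s + T)) = u := funext hper
    conv_rhs => rw [← this]
    rw [deriv_comp_add_const]
  have hi0 : IntervalIntegrable (deriv u) volume 0 T := by
    refine hvi.congr_ae ?_
    rw [uIoc_of_le hT.le]
    exact (ae_restrict_iff' measurableSet_Ioc).2 (by
      filter_upwards [hdv'] with t ht hm using (ht hm).symm)
  have hi : ∀ a b, IntervalIntegrable (deriv u) volume a b :=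
    hper'.intervalIntegrable₀ hT.ne' hi0
  have hF : ∀ t ∈ Icc 0 T, ∫ s in (0 : ℝ)..t, deriv u s = u t - u 0 := by
    intro t ht
    rw [huv t ht, add_sub_cancel_left]
    refine intervalIntegral.integral_congr_ae ?_
    rw [uIoc_of_le ht.1]
    filter_upwards [hdv'] with s hs hm using hs ⟨hm.1, hm.2.trans ht.2⟩
  -- The increment of `u` over a period is zero, so the identity known on one period extends to the
  -- whole line.
  have hFp : Function.Periodic (fun t => (∫ s in (0 : ℝ)..t, deriv u s) - u t) T := by
    intro t
    have h1 : ∫ s in t..t + T, deriv u s = 0 := by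
      rw [hper'.intervalIntegral_add_eq t 0, zero_add, hF T ⟨hT.le, le_rfl⟩, ← zero_add T, hper 0,
        sub_self]
    have h2 := intervalIntegral.integral_add_adjacent_intervals (hi 0 t) (hi t (t + T))
    simp only
    rw [← h2, h1, add_zero, hper t]
  have hall : ∀ t, ∫ s in (0 : ℝ)..t, deriv u s = u t - u 0 := by
    intro t
    obtain ⟨s, hs, hst⟩ := hFp.exists_mem_Ico₀ hT t
    have h1 := hF s (Ico_subset_Icc_self hs)
    simp only [h1] at hst
    have : (∫ s in (0 : ℝ)..t, deriv u s) = u s - u 0 - u s + u t := by rw [← hst]; abel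
    rw [this]; abel
  refine ⟨hi, fun a b => ?_⟩
  rw [← intervalIntegral.integral_interval_sub_left (hi 0 b) (hi 0 a), hall, hall]
  abel

/-! ### The action of collision-ejection paths -/

/-- The minimal action of a collision-ejection path of duration `S` for the potential
`μ / ρ ^ α`, for `α = 1`; a lower bound for `1 ≤ α < 2`. -/
noncomputable def ejectionAction (α μ S : ℝ) : ℝ :=
  (2 + α) / (2 - α) * (1 / 2) * (2 * μ) ^ (2 / (2 + α)) * (Real.pi / α) ^ (2 * α / (2 + α))
    * S ^ ((2 - α) / (2 + α))

/-- AM-GM with weights (2-α)/(2+α) and 2α/(2+α): these make the powers R^(-α) and R^(1-α/2) cancel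
in the geometric mean. -/
theorem ejectionAction_le {α μ S R : ℝ} (hα : 0 < α) (hα2 : α < 2) (hμ : 0 < μ) (hS : 0 < S)
    (hR : 0 < R) :
    ejectionAction α μ S ≤ μ * R ^ (-α) * S +
      √(2 * μ) * (2 * (R ^ (1 - α / 2) * (2 / (2 - α)) * (Real.pi / 4))) := by
  have h2 : 0 < 2 - α := by linarith
  have h3 : 0 < 2 + α := by linarith
  have hπ := Real.pi_pos
  have hq : 0 < √(2 * μ) := by positivity
  -- `p₁` and `p₂` are the two summands divided by their weights.
  set p₁ : ℝ := (2 + α) / (2 - α) * (μ * R ^ (-α) * S) with hp₁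
  set p₂ : ℝ := (2 + α) / (2 - α) * (√(2 * μ) * R ^ (1 - α / 2) * (Real.pi / (2 * α))) with hp₂
  have hp₁0 : 0 < p₁ := by positivity
  have hp₂0 : 0 < p₂ := by positivity
  have key := Real.geom_mean_le_arith_mean2_weighted (w₁ := (2 - α) / (2 + α))
    (w₂ := 2 * α / (2 + α)) (by positivity) (by positivity) hp₁0.le hp₂0.le
    (by field_simp; ring)
  have e : ejectionAction α μ S = p₁ ^ ((2 - α) / (2 + α)) * p₂ ^ (2 * α / (2 + α)) := by
    unfold ejectionAction
    apply Real.log_injOn_pos (mem_Ioi.2 (by positivity)) (mem_Ioi.2 (by positivity))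
    rw [hp₁, hp₂, Real.log_mul (by positivity) (by positivity),
      Real.log_mul (by positivity) (by positivity), Real.log_mul (by positivity) (by positivity),
      Real.log_mul (by positivity) (by positivity), Real.log_mul (by positivity) (by positivity),
      Real.log_rpow (by positivity), Real.log_rpow (by positivity), Real.log_rpow (by positivity),
      Real.log_rpow (by positivity), Real.log_rpow (by positivity),
      Real.log_mul (by positivity) (by positivity), Real.log_mul (by positivity) (by positivity),
      Real.log_mul (by positivity) (by positivity), Real.log_mul (by positivity) (by positivity),
      Real.log_mul (by positivity) (by positivity), Real.log_mul (by positivity) (by positivity),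
      Real.log_mul hq.ne' (by positivity), Real.log_rpow hR (-α), Real.log_rpow hR,
      Real.log_sqrt (by positivity),
      Real.log_mul two_ne_zero hμ.ne', Real.log_div hπ.ne' hα.ne', Real.log_div h3.ne' h2.ne',
      Real.log_div hπ.ne' (by positivity), Real.log_mul two_ne_zero hα.ne',
      Real.log_div one_ne_zero two_ne_zero,
      Real.log_one]
    field_simp
    ring
  rw [e]
  refine key.trans (le_of_eq ?_)
  rw [hp₁, hp₂]
  field_simp
  ring

theorem hasDerivAt_integral_sqrt_one_sub_sq (z : ℝ) :
    HasDerivAt (fun z => ∫ y in (0 : ℝ)..z, √(1 - y ^ 2)) (√(1 - z ^ 2)) z := by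
  have hc : Continuous fun y : ℝ => √(1 - y ^ 2) := by fun_prop
  exact intervalIntegral.integral_hasDerivAt_right (hc.intervalIntegrable _ _)
    (hc.stronglyMeasurableAtFilter _ _) hc.continuousAt

theorem integral_sqrt_one_sub_sq_zero_one : ∫ y in (0 : ℝ)..1, √(1 - y ^ 2) = Real.pi / 4 := by
  have hc : Continuous fun y : ℝ => √(1 - y ^ 2) := by fun_prop
  have h1 := intervalIntegral.integral_add_adjacent_intervals
    (hc.intervalIntegrable (-1) 0) (hc.intervalIntegrable (μ := volume) 0 1)
  have h2 : ∫ y in (-1 : ℝ)..0, √(1 - y ^ 2) = ∫ y in (0 : ℝ)..1, √(1 - y ^ 2) := by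
    have := intervalIntegral.integral_comp_neg (a := 0) (b := 1) fun y : ℝ => √(1 - y ^ 2)
    simpa using this.symm
  rw [integral_sqrt_one_sub_sq, h2] at h1
  linarith

/-- A lower bound, as a function of the radius, for the normalised speed of a radial
collision-ejection solution with maximal radius `R`. -/
noncomputable def radialSpeed (α R s : ℝ) : ℝ := s ^ (-(α / 2)) * √(1 - (s / R) ^ (2 - α))

/-- A primitive of `radialSpeed`. -/
noncomputable def radialPrimitive (α R s : ℝ) : ℝ :=
  R ^ (1 - α / 2) * (2 / (2 - α)) * ∫ y in (0 : ℝ)..(s / R) ^ (1 - α / 2), √(1 - y ^ 2)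

/-- Substitution y = (s/R)^(1-α/2), so that y² = (s/R)^(2-α). The exponent 2-α in `radialSpeed` is
what turns the integral into the area under a circle, equal to π/4 at s = R. -/
theorem hasDerivAt_radialPrimitive {α R s : ℝ} (hα2 : α < 2) (hR : 0 < R) (hs : 0 < s) :
    HasDerivAt (radialPrimitive α R) (radialSpeed α R s) s := by
  have hsR : 0 < s / R := by positivity
  have h1 : HasDerivAt (fun s : ℝ => (s / R) ^ (1 - α / 2))
      (1 / R * (1 - α / 2) * (s / R) ^ (1 - α / 2 - 1)) s :=
    ((hasDerivAt_id s).div_const R).rpow_const (Or.inl hsR.ne')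
  have h2 := ((hasDerivAt_integral_sqrt_one_sub_sq ((s / R) ^ (1 - α / 2))).comp s h1).const_mul
    (R ^ (1 - α / 2) * (2 / (2 - α)))
  refine h2.congr_deriv ?_
  have h3 : ((s / R) ^ (1 - α / 2)) ^ 2 = (s / R) ^ (2 - α) := by
    rw [← Real.rpow_natCast, ← Real.rpow_mul hsR.le]; congr 1; push_cast; ring
  have h4 : R ^ (1 - α / 2) * (s / R) ^ (1 - α / 2 - 1) = R * s ^ (-(α / 2)) := by
    rw [Real.div_rpow hs.le hR.le, show 1 - α / 2 - 1 = -(α / 2) by ring,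
      show 1 - α / 2 = 1 + -(α / 2) by ring, Real.rpow_add hR, Real.rpow_one]
    have := Real.rpow_pos_of_pos hR (-(α / 2))
    field_simp
  have h5 : (2 - α) ≠ 0 := by linarith
  rw [h3, radialSpeed]
  calc _ = (R ^ (1 - α / 2) * (s / R) ^ (1 - α / 2 - 1)) / R * √(1 - (s / R) ^ (2 - α)) *
        ((2 / (2 - α)) * (1 - α / 2)) := by ring
    _ = _ := by
      rw [h4]
      field_simp

theorem radialSpeed_nonneg {α R s : ℝ} (hs : 0 ≤ s) : 0 ≤ radialSpeed α R s :=
  mul_nonneg (Real.rpow_nonneg hs _) (Real.sqrt_nonneg _)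

/-- Since s/R ≤ 1 and 2 - α ≤ α, replacing the exponent α by 2 - α only decreases 1 - (s/R)^α; this
is where α ≥ 1 enters, with equality at α = 1. -/
theorem radialSpeed_sq_le {α R s : ℝ} (hα : 1 ≤ α) (hR : 0 < R) (hs : 0 < s) (hsR : s ≤ R) :
    radialSpeed α R s ^ 2 ≤ s ^ (-α) - R ^ (-α) := by
  have h1 : (s ^ (-(α / 2))) ^ 2 = s ^ (-α) := by
    rw [← Real.rpow_natCast, ← Real.rpow_mul hs.le]; congr 1; push_cast; ring
  have hq : s / R ≤ 1 := (div_le_one hR).2 hsR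
  have h2 : (s / R) ^ α ≤ (s / R) ^ (2 - α) :=
    Real.rpow_le_rpow_of_exponent_ge (by positivity) hq (by linarith)
  have h3 : s ^ (-α) * (s / R) ^ α = R ^ (-α) := by
    rw [Real.div_rpow hs.le hR.le, Real.rpow_neg hs.le, Real.rpow_neg hR.le]
    have := Real.rpow_pos_of_pos hs α
    field_simp
  have h4 : √(1 - (s / R) ^ (2 - α)) ^ 2 ≤ 1 - (s / R) ^ α := by
    rcases le_total 0 (1 - (s / R) ^ (2 - α)) with h | h
    · rw [Real.sq_sqrt h]; linarith
    · rw [Real.sqrt_eq_zero_of_nonpos h]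
      have := Real.rpow_le_one (by positivity) hq (by linarith : 0 ≤ α)
      nlinarith
  rw [radialSpeed, mul_pow, h1]
  calc _ ≤ s ^ (-α) * (1 - (s / R) ^ α) :=
        mul_le_mul_of_nonneg_left h4 (Real.rpow_nonneg hs.le _)
    _ = _ := by rw [mul_sub, h3, mul_one]

/-- Completing the square in ‖v‖ - √(2μ)·`radialSpeed`. The cut-off `δ` keeps the speed bounded near
the collision. -/
theorem lagrangian_ge {E : Type*} [NormedAddCommGroup E] {α μ R δ : ℝ} (hα : 1 ≤ α) (hμ : 0 < μ) (hδ : 0 < δ) (hδR : δ ≤ R)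
    {x v : E} (hx : ‖x‖ ≤ R) :
    ENNReal.ofReal (μ * R ^ (-α) + √(2 * μ) * (radialSpeed α R (max ‖x‖ δ) * ‖v‖)) ≤
      ‖v‖ₑ ^ 2 / 2 + ENNReal.ofReal μ / ‖x‖ₑ ^ α := by
  have hα0 : 0 < α := by linarith
  rcases eq_or_ne x 0 with rfl | h0
  · rw [enorm_zero, ENNReal.zero_rpow_of_pos hα0, ENNReal.div_zero (by simpa using hμ)]
    simp
  have hn : 0 < ‖x‖ := norm_pos_iff.2 h0
  have hR : 0 < R := hδ.trans_le hδR
  have e : ‖v‖ₑ ^ 2 / 2 + ENNReal.ofReal μ / ‖x‖ₑ ^ α =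
      ENNReal.ofReal (‖v‖ ^ 2 / 2 + μ * ‖x‖ ^ (-α)) := by
    rw [ENNReal.ofReal_add (by positivity) (by positivity), Real.rpow_neg hn.le, ← div_eq_mul_inv,
      ENNReal.ofReal_div_of_pos (by positivity), ENNReal.ofReal_div_of_pos (by positivity),
      ENNReal.ofReal_pow (norm_nonneg _), ofReal_norm, ← ENNReal.ofReal_rpow_of_pos hn, ofReal_norm]
    simp
  rw [e]
  apply ENNReal.ofReal_le_ofReal
  have hm : max ‖x‖ δ ≤ R := max_le hx hδR
  have hm0 : 0 < max ‖x‖ δ := lt_max_of_lt_right hδ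
  have h1 := radialSpeed_sq_le hα hR hm0 hm
  have h2 : (max ‖x‖ δ) ^ (-α) ≤ ‖x‖ ^ (-α) :=
    Real.rpow_le_rpow_of_nonpos hn (le_max_left _ _) (by linarith)
  have h3 := Real.sq_sqrt (show 0 ≤ 2 * μ by positivity)
  have h4 := sq_nonneg (‖v‖ - √(2 * μ) * radialSpeed α R (max ‖x‖ δ))
  have h5 : μ * radialSpeed α R (max ‖x‖ δ) ^ 2 ≤ μ * (‖x‖ ^ (-α) - R ^ (-α)) :=
    mul_le_mul_of_nonneg_left (by linarith) hμ.le
  have h6 : (‖v‖ - √(2 * μ) * radialSpeed α R (max ‖x‖ δ)) ^ 2 =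
      ‖v‖ ^ 2 - 2 * (√(2 * μ) * (radialSpeed α R (max ‖x‖ δ) * ‖v‖)) +
      √(2 * μ) ^ 2 * radialSpeed α R (max ‖x‖ δ) ^ 2 := by ring
  rw [h6, h3] at h4
  linarith

theorem IsACPath.ejectionAction_le_lintegral {E : Type*} [NormedAddCommGroup E]
    [InnerProductSpace ℝ E] [CompleteSpace E] {u : ℝ → E} (hu : IsACPath u) {α μ a b : ℝ}
    (hα : 1 ≤ α) (hα2 : α < 2) (hμ : 0 < μ) (hab : a < b) (ha : u a = 0) (hb : u b = 0) :
    ENNReal.ofReal (ejectionAction α μ (b - a)) ≤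
      ∫⁻ t in Ioc a b, (‖deriv u t‖ₑ ^ 2 / 2 + ENNReal.ofReal μ / ‖u t‖ₑ ^ α) := by
  have hα0 : 0 < α := by linarith
  obtain ⟨m, hm, hmax⟩ := isCompact_Icc.exists_isMaxOn (nonempty_Icc.2 hab.le)
    hu.continuous.norm.continuousOn
  have hmax' : ∀ t ∈ Ioc a b, ‖u t‖ ≤ ‖u m‖ := fun t ht => hmax (Ioc_subset_Icc_self ht)
  rcases (norm_nonneg (u m)).eq_or_lt with h0 | hR
  · have : ∫⁻ t in Ioc a b, (⊤ : ℝ≥0∞) ≤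
        ∫⁻ t in Ioc a b, (‖deriv u t‖ₑ ^ 2 / 2 + ENNReal.ofReal μ / ‖u t‖ₑ ^ α) := by
      refine setLIntegral_mono' measurableSet_Ioc fun t ht => ?_
      have : u t = 0 := norm_le_zero_iff.1 (h0 ▸ hmax' t ht)
      rw [this, enorm_zero, ENNReal.zero_rpow_of_pos hα0, ENNReal.div_zero (by simpa using hμ)]
      simp
    refine le_trans ?_ this
    simp [ENNReal.top_mul, hab]
  set R := ‖u m‖ with hRdef
  -- `radialSpeed` is unbounded at 0, so the estimate is proved for the speed frozen below radius
  -- `δ`, and then `δ` tends to 0.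
  have hlim : Tendsto (fun δ => μ * R ^ (-α) * (b - a) +
      √(2 * μ) * (2 * (radialPrimitive α R R - radialPrimitive α R δ))) (𝓝[>] 0)
      (𝓝 (μ * R ^ (-α) * (b - a) + √(2 * μ) * (2 * (radialPrimitive α R R - 0)))) := by
    have hc : ContinuousAt (radialPrimitive α R) 0 := by
      unfold radialPrimitive
      refine ContinuousAt.mul continuousAt_const ?_
      have h1 : Continuous fun z => ∫ y in (0 : ℝ)..z, √(1 - y ^ 2) :=
        continuous_iff_continuousAt.2 fun z =>
          (hasDerivAt_integral_sqrt_one_sub_sq z).continuousAt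
      have h2 : Continuous fun s : ℝ => (s / R) ^ (1 - α / 2) :=
        (continuous_id.div_const R).rpow_const fun _ => Or.inr (by linarith)
      exact (h1.comp h2).continuousAt
    have hz : radialPrimitive α R 0 = 0 := by
      simp [radialPrimitive, Real.zero_rpow (by linarith : (1 - α / 2) ≠ 0)]
    have h1 : Tendsto (radialPrimitive α R) (𝓝[>] 0) (𝓝 0) := by
      have := hc.tendsto
      rw [hz] at this
      exact this.mono_left nhdsWithin_le_nhds
    exact ((((tendsto_const_nhds.sub h1).const_mul 2).const_mul _)).const_add _
  have hRR : radialPrimitive α R R = R ^ (1 - α / 2) * (2 / (2 - α)) * (Real.pi / 4) := by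
    rw [radialPrimitive, div_self hR.ne', Real.one_rpow, integral_sqrt_one_sub_sq_zero_one]
  have hfin := ejectionAction_le hα0 hα2 hμ (sub_pos.2 hab) hR
  rw [← hRR, ← sub_zero (radialPrimitive α R R)] at hfin
  refine (ENNReal.ofReal_le_ofReal hfin).trans ?_
  refine le_of_tendsto (ENNReal.tendsto_ofReal hlim) ?_
  filter_upwards [Ioo_mem_nhdsGT hR] with δ hδ
  set ψ : ℝ → ℝ := fun s => radialSpeed α R (max s δ) with hψdef
  have hmpos : ∀ s, 0 < max s δ := fun s => lt_max_of_lt_right hδ.1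
  have hψ : Continuous ψ := by
    have h1 : Continuous fun s : ℝ => max s δ := continuous_id.max continuous_const
    refine (h1.rpow_const fun s => Or.inl (hmpos s).ne').mul (Continuous.sqrt ?_)
    exact continuous_const.sub ((h1.div_const R).rpow_const fun s => Or.inr (by linarith))
  have hψ0 : ∀ s, 0 ≤ ψ s := fun s => radialSpeed_nonneg (hmpos s).le
  have hψC : ∀ s, ψ s ≤ δ ^ (-(α / 2)) := fun s => by
    have h1 : (max s δ) ^ (-(α / 2)) ≤ δ ^ (-(α / 2)) :=
      Real.rpow_le_rpow_of_nonpos hδ.1 (le_max_right _ _) (by linarith)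
    have h2 : √(1 - (max s δ / R) ^ (2 - α)) ≤ 1 := by
      rw [Real.sqrt_le_left one_pos.le]
      have := Real.rpow_nonneg (div_nonneg (hmpos s).le hR.le) (2 - α)
      linarith
    exact (mul_le_of_le_one_right (Real.rpow_nonneg (hmpos s).le _) h2).trans h1
  have hint : radialPrimitive α R R - radialPrimitive α R δ ≤ ∫ s in (0 : ℝ)..R, ψ s := by
    have h1 : ∫ s in δ..R, ψ s = radialPrimitive α R R - radialPrimitive α R δ := by
      refine intervalIntegral.integral_eq_sub_of_hasDerivAt (fun s hs => ?_)
        (hψ.intervalIntegrable _ _)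
      rw [uIcc_of_le hδ.2.le] at hs
      rw [hψdef]
      simp only [max_eq_left hs.1]
      exact hasDerivAt_radialPrimitive hα2 hR (hδ.1.trans_le hs.1)
    have h2 := intervalIntegral.integral_add_adjacent_intervals
      (hψ.intervalIntegrable (μ := volume) 0 δ) (hψ.intervalIntegrable δ R)
    have h3 : 0 ≤ ∫ s in (0 : ℝ)..δ, ψ s :=
      intervalIntegral.integral_nonneg hδ.1.le fun s _ => hψ0 s
    linarith
  have hii : ∀ x y, IntervalIntegrable (fun t => ψ ‖u t‖ * ‖deriv u t‖) volume x y := fun x y =>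
    (hu.intervalIntegrable x y).norm.continuousOn_mul (hψ.comp hu.continuous.norm).continuousOn
  -- Two legs: from the origin out to radius `R` on [a, m], and back on [m, b].
  have hpath : 2 * (radialPrimitive α R R - radialPrimitive α R δ) ≤
      ∫ t in a..b, ψ ‖u t‖ * ‖deriv u t‖ := by
    have h1 := (le_abs_self _).trans (hu.integral_comp_norm_le hψ hψ0 hψC hm.1)
    have h2 := (neg_le_abs _).trans (hu.integral_comp_norm_le hψ hψ0 hψC hm.2)
    rw [← intervalIntegral.integral_symm, hb, norm_zero] at h2
    rw [ha, norm_zero] at h1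
    rw [← intervalIntegral.integral_add_adjacent_intervals (hii a m) (hii m b)]
    linarith
  calc ENNReal.ofReal (μ * R ^ (-α) * (b - a) +
        √(2 * μ) * (2 * (radialPrimitive α R R - radialPrimitive α R δ)))
      ≤ ENNReal.ofReal (∫ t in a..b, (μ * R ^ (-α) + √(2 * μ) * (ψ ‖u t‖ * ‖deriv u t‖))) := by
        apply ENNReal.ofReal_le_ofReal
        rw [intervalIntegral.integral_add (by simp) ((hii a b).const_mul _),
          intervalIntegral.integral_const_mul (√(2 * μ)), intervalIntegral.integral_const,
          smul_eq_mul, mul_comm (b - a)]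
        exact add_le_add_right (mul_le_mul_of_nonneg_left hpath (Real.sqrt_nonneg _)) _
    _ = ∫⁻ t in Ioc a b, ENNReal.ofReal
          (μ * R ^ (-α) + √(2 * μ) * (ψ ‖u t‖ * ‖deriv u t‖)) := by
        rw [intervalIntegral.integral_of_le hab.le]
        refine ofReal_integral_eq_lintegral_ofReal ?_ (Eventually.of_forall fun t => ?_)
        · exact ((intervalIntegrable_const (c := μ * R ^ (-α))).add
            ((hii a b).const_mul (√(2 * μ)))).1
        · have := hψ0 ‖u t‖
          simp only [Pi.zero_apply]
          positivity
    _ ≤ _ := setLIntegral_mono' measurableSet_Ioc fun t ht =>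
        lagrangian_ge hα hμ hδ.1 hδ.2.le (hmax' t ht)

/-! ### Rotations about a pole -/

theorem crossNorm_nonneg (x p : R3) : 0 ≤ crossNorm x p := norm_nonneg _

theorem crossNorm_sq (x p : R3) : crossNorm x p ^ 2 = ‖x‖ ^ 2 * ‖p‖ ^ 2 - inner ℝ x p ^ 2 := by
  rw [crossNorm, EuclideanSpace.norm_sq_eq, EuclideanSpace.norm_sq_eq, EuclideanSpace.norm_sq_eq,
    PiLp.inner_apply]
  simp only [Fin.sum_univ_three, Real.norm_eq_abs, sq_abs, cross_apply]
  simp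
  ring

theorem crossNorm_le (x p : R3) : crossNorm x p ≤ ‖x‖ * ‖p‖ := by
  refine le_of_sq_le_sq ?_ (by positivity)
  rw [crossNorm_sq, mul_pow]
  linarith [sq_nonneg (inner ℝ x p)]

theorem exists_orthonormalBasis_apply_two {p : R3} (hp : ‖p‖ = 1) :
    ∃ b : OrthonormalBasis (Fin 3) ℝ R3, b 2 = p := by
  have h : Orthonormal ℝ (({2} : Set (Fin 3)).domRestrict fun _ => p) := by
    constructor
    · intro i; exact hp
    · intro i j hij
      exact absurd (Subsingleton.elim i j) hij
  obtain ⟨b, hb⟩ := h.exists_orthonormalBasis_extension_of_card_eq (by simp)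
  exact ⟨b, hb 2 rfl⟩

section Rotation

variable {p : R3} {b : OrthonormalBasis (Fin 3) ℝ R3} {R : R3 ≃ₗᵢ[ℝ] R3}

/-- On the plane orthogonal to p the matrix has unit columns (a, c), (d, e) and determinant 1,
whence (a - e)² + (c + d)² = 0. -/
theorem rotation_entries (hb : b 2 = p)
    (hdet : LinearMap.det (R.toLinearEquiv : R3 →ₗ[ℝ] R3) = 1) (hR : R p = p) :
    R (b 0) = inner ℝ (b 0) (R (b 0)) • b 0 + inner ℝ (b 1) (R (b 0)) • b 1 ∧
    R (b 1) = -inner ℝ (b 1) (R (b 0)) • b 0 + inner ℝ (b 0) (R (b 0)) • b 1 := by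
  have hp0 : inner ℝ p (R (b 0)) = 0 := by
    rw [← hR, R.inner_map_map, ← hb]; exact b.orthonormal.2 (by decide)
  have hp1 : inner ℝ p (R (b 1)) = 0 := by
    rw [← hR, R.inner_map_map, ← hb]; exact b.orthonormal.2 (by decide)
  have e0 := b.sum_repr' (R (b 0))
  have e1 := b.sum_repr' (R (b 1))
  have n0 := b.sum_sq_inner_right (R (b 0))
  have n1 := b.sum_sq_inner_right (R (b 1))
  rw [R.norm_map, b.norm_eq_one, Fin.sum_univ_three, hb, hp0] at n0
  rw [R.norm_map, b.norm_eq_one, Fin.sum_univ_three, hb, hp1] at n1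
  rw [Fin.sum_univ_three, hb, hp0, zero_smul, add_zero] at e0
  rw [Fin.sum_univ_three, hb, hp1, zero_smul, add_zero] at e1
  rw [← LinearMap.det_toMatrix b.toBasis, Matrix.det_fin_three] at hdet
  have hent : ∀ i j, LinearMap.toMatrix b.toBasis b.toBasis (R.toLinearEquiv : R3 →ₗ[ℝ] R3) i j =
      inner ℝ (b i) (R (b j)) := fun i j => by
    rw [LinearMap.toMatrix_apply, OrthonormalBasis.coe_toBasis,
      OrthonormalBasis.coe_toBasis_repr_apply, OrthonormalBasis.repr_apply_apply]
    rfl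
  have h02 : inner ℝ (b 0) (R (b 2)) = 0 := by
    rw [hb, hR, ← hb]; exact b.orthonormal.2 (by decide)
  have h12 : inner ℝ (b 1) (R (b 2)) = 0 := by
    rw [hb, hR, ← hb]; exact b.orthonormal.2 (by decide)
  have h22 : inner ℝ (b 2) (R (b 2)) = 1 := by
    rw [hb, hR, real_inner_self_eq_norm_sq, ← hb, b.norm_eq_one, one_pow]
  simp only [hent] at hdet
  rw [h02, h12, h22] at hdet
  set a := inner ℝ (b 0) (R (b 0))
  set c := inner ℝ (b 1) (R (b 0))
  set d := inner ℝ (b 0) (R (b 1))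
  set e := inner ℝ (b 1) (R (b 1))
  have hs : (a - e) ^ 2 + (c + d) ^ 2 = 0 := by linear_combination n0 + n1 - 2 * hdet
  have h1 : a - e = 0 := by nlinarith [sq_nonneg (a - e), sq_nonneg (c + d)]
  have h2 : c + d = 0 := by nlinarith [sq_nonneg (a - e), sq_nonneg (c + d)]
  refine ⟨e0.symm, ?_⟩
  rw [← e1, show d = -c by linarith, show e = a by linarith]

/-- R - 1 kills p and acts on the orthogonal plane as multiplication by (a - 1) + ic; |x × p| is the
length of the projection of x to that plane. -/
theorem rotation_norm_sub_sq (hb : b 2 = p)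
    (hdet : LinearMap.det (R.toLinearEquiv : R3 →ₗ[ℝ] R3) = 1) (hRp : R p = p) (x : R3) :
    ‖R x - x‖ ^ 2 = ((inner ℝ (b 0) (R (b 0)) - 1) ^ 2 + inner ℝ (b 1) (R (b 0)) ^ 2) *
      crossNorm x p ^ 2 := by
  obtain ⟨hR, hR'⟩ := rotation_entries hb hdet hRp
  have hx := b.sum_repr' x
  have hnx := b.sum_sq_inner_right x
  rw [Fin.sum_univ_three, hb] at hx hnx
  have hp : ‖p‖ = 1 := by rw [← hb, b.norm_eq_one]
  generalize inner ℝ (b 0) (R (b 0)) = a at *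
  generalize inner ℝ (b 1) (R (b 0)) = c at *
  rw [crossNorm_sq, hp, real_inner_comm p x, ← hnx]
  generalize inner ℝ (b 0) x = x0 at *
  generalize inner ℝ (b 1) x = x1 at *
  have hd : R x - x = ((a - 1) * x0 - c * x1) • b 0 + (c * x0 + (a - 1) * x1) • b 1 := by
    conv_lhs => rw [← hx]
    rw [map_add, map_add, map_smul, map_smul, map_smul, hRp, hR, hR']
    module
  have h01 : inner ℝ (b 0) (b 1) = (0 : ℝ) := b.orthonormal.2 (by decide)
  rw [hd, norm_add_sq_real, inner_smul_left, inner_smul_right, h01, norm_smul, norm_smul,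
    b.norm_eq_one, b.norm_eq_one, mul_one, mul_one, Real.norm_eq_abs, Real.norm_eq_abs, sq_abs,
    sq_abs]
  ring

end Rotation

/-- A group of rotations about the unit vector `p` embeds in the unit circle, by the angle. -/
theorem exists_rotation_character {p : R3} (hp : ‖p‖ = 1) (K : Subgroup (R3 ≃ₗᵢ[ℝ] R3))
    (hK : ∀ R ∈ K, LinearMap.det (R.toLinearEquiv : R3 →ₗ[ℝ] R3) = 1 ∧ R p = p) :
    ∃ χ : K →* ℂ, ∀ (R : K) (x : R3), ‖R.1 x - x‖ = ‖χ R - 1‖ * crossNorm x p := by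
  obtain ⟨b, hb⟩ := exists_orthonormalBasis_apply_two hp
  have h00 : inner ℝ (b 0) (b 0) = (1 : ℝ) := by
    rw [real_inner_self_eq_norm_sq, b.norm_eq_one, one_pow]
  have h11 : inner ℝ (b 1) (b 1) = (1 : ℝ) := by
    rw [real_inner_self_eq_norm_sq, b.norm_eq_one, one_pow]
  have h01 : inner ℝ (b 0) (b 1) = (0 : ℝ) := b.orthonormal.2 (by decide)
  have h10 : inner ℝ (b 1) (b 0) = (0 : ℝ) := b.orthonormal.2 (by decide)
  refine ⟨⟨⟨fun R => ⟨inner ℝ (b 0) (R.1 (b 0)), inner ℝ (b 1) (R.1 (b 0))⟩, ?_⟩, ?_⟩, ?_⟩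
  · apply Complex.ext
    · simp
    · simp [h10]
  · intro R S
    obtain ⟨hR, hR'⟩ := rotation_entries hb (hK R.1 R.2).1 (hK R.1 R.2).2
    obtain ⟨hS, -⟩ := rotation_entries hb (hK S.1 S.2).1 (hK S.1 S.2).2
    have e : (R * S).1 (b 0) = R.1 (S.1 (b 0)) := rfl
    simp only [e]
    rw [hS, map_add, map_smul, map_smul, hR']
    apply Complex.ext
    · simp [inner_add_right, inner_smul_right, h10, h01]; ring
    · simp [inner_add_right, inner_smul_right, h10, h01]; ring
  · intro R x
    refine (pow_left_inj₀ (norm_nonneg _)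
      (mul_nonneg (norm_nonneg _) (crossNorm_nonneg x p)) two_ne_zero).1 ?_
    rw [mul_pow, rotation_norm_sub_sq hb (hK R.1 R.2).1 (hK R.1 R.2).2, Complex.sq_norm,
      Complex.normSq_apply]
    simp [pow_two]

/-- The image of χ consists of roots of unity of order dividing |K|, and by counting it is all of
them. -/
theorem sum_comp_character {K : Type*} [Group K] [Fintype K] (χ : K →* ℂ)
    (hχ : Function.Injective χ) (H : ℂ → ℝ) :
    ∑ R : K, H (χ R) =
      ∑ j ∈ Finset.range (Nat.card K),
        H (Complex.exp (2 * Real.pi * Complex.I / Nat.card K) ^ j) := by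
  classical
  set o := Nat.card K with ho
  have ho0 : 0 < o := Nat.card_pos
  have hζ : IsPrimitiveRoot (Complex.exp (2 * Real.pi * Complex.I / o)) o :=
    Complex.isPrimitiveRoot_exp o ho0.ne'
  set ζ := Complex.exp (2 * Real.pi * Complex.I / o)
  have hcard := hζ.card_nthRootsFinset
  have h1 : Finset.univ.image χ = Polynomial.nthRootsFinset o (1 : ℂ) := by
    refine Finset.eq_of_subset_of_card_le (fun z hz => ?_) ?_
    · obtain ⟨R, -, rfl⟩ := Finset.mem_image.1 hz
      rw [Polynomial.mem_nthRootsFinset ho0, ← map_pow, pow_card_eq_one', map_one]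
    · rw [hcard, Finset.card_image_of_injective _ hχ, Finset.card_univ, ho,
        Nat.card_eq_fintype_card]
  have hinj : Set.InjOn (fun j => ζ ^ j) (Finset.range o : Set ℕ) := fun i hi j hj h =>
    hζ.pow_inj (Finset.mem_range.1 hi) (Finset.mem_range.1 hj) h
  have h2 : (Finset.range o).image (fun j => ζ ^ j) = Polynomial.nthRootsFinset o (1 : ℂ) := by
    refine Finset.eq_of_subset_of_card_le (fun z hz => ?_) ?_
    · obtain ⟨j, -, rfl⟩ := Finset.mem_image.1 hz
      rw [Polynomial.mem_nthRootsFinset ho0, ← pow_mul, mul_comm, pow_mul, hζ.pow_eq_one, one_pow]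
    · rw [hcard, Finset.card_image_of_injOn hinj, Finset.card_range]
  rw [← Finset.sum_image (s := Finset.univ) (g := χ) (f := H) fun a _ b _ h => hχ h, h1, ← h2,
    Finset.sum_image hinj]

theorem norm_exp_pow_sub_one {o j : ℕ} (hj : j < o) :
    ‖Complex.exp (2 * Real.pi * Complex.I / o) ^ j - 1‖ = 2 * Real.sin (j * Real.pi / o) := by
  have ho : 0 < (o : ℝ) := by exact_mod_cast (Nat.zero_le j).trans_lt hj
  have e : Complex.exp (2 * Real.pi * Complex.I / o) ^ j =
      Complex.exp (Complex.I * ((2 * (j * Real.pi / o) : ℝ) : ℂ)) := by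
    rw [← Complex.exp_nat_mul]
    congr 1
    push_cast
    ring
  rw [e, Complex.norm_exp_I_mul_ofReal_sub_one, mul_div_cancel_left₀ _ two_ne_zero,
    Real.norm_of_nonneg]
  have hs : 0 ≤ Real.sin (j * Real.pi / o) := by
    apply Real.sin_nonneg_of_nonneg_of_le_pi
    · positivity
    · rw [div_le_iff₀ ho, mul_comm]
      have : (j : ℝ) ≤ o := by exact_mod_cast hj.le
      exact mul_le_mul_of_nonneg_left this Real.pi_pos.le
  positivity

theorem sin_pole_nonneg {o j : ℕ} (hj : j < o) : 0 ≤ Real.sin (j * Real.pi / o) := by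
  have := norm_exp_pow_sub_one hj
  have h := norm_nonneg (Complex.exp (2 * Real.pi * Complex.I / o) ^ j - 1)
  linarith

theorem poleCoeff_nonneg (G : Subgroup (R3 ≃ₗᵢ[ℝ] R3)) (α : ℝ) (p : R3) : 0 ≤ poleCoeff G α p :=
  Finset.sum_nonneg fun _ hj =>
    div_nonneg zero_le_one (Real.rpow_nonneg (sin_pole_nonneg (Finset.mem_Ico.1 hj).2) _)

/-- The subgroup of the elements of `G` that fix `p`. -/
def axisStabilizer (G : Subgroup (R3 ≃ₗᵢ[ℝ] R3)) (p : R3) : Subgroup (R3 ≃ₗᵢ[ℝ] R3) where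
  carrier := {R | R ∈ G ∧ R p = p}
  one_mem' := ⟨one_mem _, rfl⟩
  mul_mem' := by
    rintro R S ⟨hR, hR'⟩ ⟨hS, hS'⟩
    refine ⟨mul_mem hR hS, ?_⟩
    change R (S p) = p
    rw [hS', hR']
  inv_mem' := by
    rintro R ⟨hR, hR'⟩
    refine ⟨inv_mem hR, ?_⟩
    change R.symm p = p
    rw [LinearIsometryEquiv.symm_apply_eq, hR']

/-! ### Summing the potential over the poles -/

section Group

variable {G : Subgroup (R3 ≃ₗᵢ[ℝ] R3)}
  (hG : ∀ R ∈ G, LinearMap.det (R.toLinearEquiv : R3 →ₗ[ℝ] R3) = 1)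

include hG

theorem exists_stabilizer_character {p : R3} (hp : ‖p‖ = 1) :
    ∃ χ : axisStabilizer G p →* ℂ, Function.Injective χ ∧
      ∀ (R : axisStabilizer G p) (x : R3), ‖R.1 x - x‖ = ‖χ R - 1‖ * crossNorm x p := by
  obtain ⟨χ, h⟩ := exists_rotation_character hp (axisStabilizer G p) fun R hR =>
    ⟨hG R hR.1, hR.2⟩
  refine ⟨χ, ?_, h⟩
  rw [injective_iff_map_eq_one]
  intro R hR
  ext1
  ext1 x
  have := h R x
  rw [hR, sub_self, norm_zero, zero_mul, norm_eq_zero, sub_eq_zero] at this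
  exact this

theorem eq_or_eq_neg_of_fixed {R : R3 ≃ₗᵢ[ℝ] R3} (hR : R ∈ G) (hR1 : R ≠ 1) {p q : R3}
    (hp : ‖p‖ = 1) (hq : ‖q‖ = 1) (hRp : R p = p) (hRq : R q = q) : q = p ∨ q = -p := by
  obtain ⟨χ, hinj, h⟩ := exists_stabilizer_character hG hp
  have h1 := h ⟨R, hR, hRp⟩ q
  have h2 : χ ⟨R, hR, hRp⟩ - 1 ≠ 0 := fun h0 => hR1 (by
    have := hinj ((sub_eq_zero.1 h0).trans (map_one χ).symm)
    exact congrArg Subtype.val this)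
  simp only [hRq, sub_self, norm_zero] at h1
  have h3 : crossNorm q p = 0 := by
    rcases mul_eq_zero.1 h1.symm with h | h
    · exact absurd (norm_eq_zero.1 h) h2
    · exact h
  have h4 := crossNorm_sq q p
  rw [h3, hp, hq] at h4
  have h5 : (inner ℝ q p - 1) * (inner ℝ q p + 1) = (0 : ℝ) := by linear_combination h4
  rcases mul_eq_zero.1 h5 with h | h
  · left
    exact (inner_eq_one_iff_of_norm_eq_one (𝕜 := ℝ) hq hp).1 (by linarith)
  · right
    exact (inner_eq_one_iff_of_norm_eq_one (𝕜 := ℝ) hq (by rwa [norm_neg])).1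
      (by rw [inner_neg_right]; linarith)

theorem sum_stabilizer_eq {p : R3} (hp : ‖p‖ = 1) {α : ℝ} (hα : 0 < α) (x : R3)
    [Fintype (axisStabilizer G p)] :
    ∑ R : axisStabilizer G p, 1 / ‖R.1 x - x‖ ^ α =
      poleCoeff G α p / (2 ^ α * crossNorm x p ^ α) := by
  obtain ⟨χ, hinj, h⟩ := exists_stabilizer_character hG hp
  have ho : poleOrder G p = Nat.card (axisStabilizer G p) := rfl
  simp only [h]
  rw [sum_comp_character χ hinj fun z => 1 / (‖z - 1‖ * crossNorm x p) ^ α, poleCoeff, ho,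
    Finset.sum_div]
  have hpos : 0 < Nat.card (axisStabilizer G p) := Nat.card_pos
  -- The term j = 0 is the identity, whose summand 1/0 is 0 by convention; removing it leaves the
  -- range of `poleCoeff`.
  rw [Finset.range_eq_Ico, Finset.sum_eq_sum_Ico_succ_bot hpos]
  simp only [pow_zero, sub_self, norm_zero, zero_mul, Real.zero_rpow hα.ne', div_zero, zero_add]
  refine Finset.sum_congr rfl fun j hj => ?_
  have hj' := (Finset.mem_Ico.1 hj).2
  rw [norm_exp_pow_sub_one hj', Real.mul_rpow (mul_nonneg zero_le_two (sin_pole_nonneg hj'))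
    (crossNorm_nonneg _ _), Real.mul_rpow zero_le_two (sin_pole_nonneg hj'), div_div]
  congr 1
  ring

omit hG in
theorem sum_one_div_nonneg (S : Finset (R3 ≃ₗᵢ[ℝ] R3)) (α : ℝ) (x : R3) :
    0 ≤ ∑ R ∈ S, 1 / ‖R x - x‖ ^ α :=
  Finset.sum_nonneg fun _ _ => by positivity

/-- Double counting of pairs (pole, rotation fixing it): a non-identity rotation occurs at most
twice, which accounts for the extra factor 2 in 2^(α+1). -/
theorem sum_poles_le [Finite G] {α : ℝ} (hα : 0 < α) (x : R3) (S : Finset (R3 ≃ₗᵢ[ℝ] R3))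
    (hS : ∀ R, R ∈ S ↔ R ∈ G) (F : Finset (poles G)) :
    1 / 2 ^ (α + 1) * ∑ p ∈ F, poleCoeff G α p / crossNorm x p ^ α ≤
      ∑ R ∈ S, 1 / ‖R x - x‖ ^ α := by
  classical
  have h1 : ∀ p ∈ F, poleCoeff G α p / crossNorm x p ^ α =
      2 ^ α * ∑ R ∈ S with R p.1 = p.1, 1 / ‖R x - x‖ ^ α := by
    intro p _
    have hp : ‖p.1‖ = 1 := by simpa using p.2.2
    have : Finite (axisStabilizer G p.1) :=
      Finite.of_injective (fun R => (⟨R.1, R.2.1⟩ : G)) fun R R' h => by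
        ext1; exact congrArg (fun z : G => z.1) h
    have := Fintype.ofFinite (axisStabilizer G p.1)
    have e : ∑ R ∈ S with R p.1 = p.1, 1 / ‖R x - x‖ ^ α =
        ∑ R : axisStabilizer G p.1, 1 / ‖R.1 x - x‖ ^ α := by
      exact Finset.sum_subtype (p := fun R => R ∈ axisStabilizer G p.1) _ (fun R => by
        rw [Finset.mem_filter, hS]; rfl) fun R => 1 / ‖R x - x‖ ^ α
    rw [e, sum_stabilizer_eq hG hp hα]
    have : (0 : ℝ) < 2 ^ α := by positivity
    rw [mul_div_assoc', mul_div_mul_left _ _ this.ne']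
  rw [Finset.sum_congr rfl h1, ← Finset.mul_sum, Real.rpow_add two_pos, Real.rpow_one]
  have h2 : ∑ p ∈ F, ∑ R ∈ S with R p.1 = p.1, 1 / ‖R x - x‖ ^ α ≤
      2 * ∑ R ∈ S, 1 / ‖R x - x‖ ^ α := by
    simp only [Finset.sum_filter]
    rw [Finset.sum_comm, Finset.mul_sum]
    refine Finset.sum_le_sum fun R hR => ?_
    rw [← Finset.sum_filter, Finset.sum_const, nsmul_eq_mul]
    by_cases hR1 : R = 1
    · subst hR1; simp [Real.zero_rpow hα.ne']
    refine mul_le_mul_of_nonneg_right ?_ (by positivity)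
    rcases (F.filter fun p => R p.1 = p.1).eq_empty_or_nonempty with h | ⟨p, hp⟩
    · rw [h]; simp
    · have hp1 : ‖p.1‖ = 1 := by simpa using p.2.2
      have hsub : ((F.filter fun p => R p.1 = p.1).image Subtype.val) ⊆ {p.1, -p.1} := by
        intro q hq
        obtain ⟨q, hqF, rfl⟩ := Finset.mem_image.1 hq
        have hq1 : ‖q.1‖ = 1 := by simpa using q.2.2
        have := eq_or_eq_neg_of_fixed hG ((hS R).1 hR) hR1 hp1 hq1 (Finset.mem_filter.1 hp).2
          (Finset.mem_filter.1 hqF).2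
        simpa using this
      have := (Finset.card_le_card hsub).trans Finset.card_le_two
      rw [Finset.card_image_of_injective _ Subtype.val_injective] at this
      exact_mod_cast this
  have h3 : (0 : ℝ) < 2 ^ α := by positivity
  calc _ = (1 / 2) * ∑ p ∈ F, ∑ R ∈ S with R p.1 = p.1, 1 / ‖R x - x‖ ^ α := by
        field_simp
    _ ≤ _ := by linarith

theorem potentialBound_le [Finite G] {α : ℝ} (hα : 0 < α) {τ : Set R3}
    (hτ : τ ⊆ Metric.sphere 0 1) {y : R3} (hy : y ∈ closure τ) (hyG : y ∉ collisionSet G)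
    (S : Finset (R3 ≃ₗᵢ[ℝ] R3)) (hS : ∀ R, R ∈ S ↔ R ∈ G) :
    potentialBound G τ α ≤ ∑ R ∈ S, 1 / ‖R y - y‖ ^ α := by
  have hcl : closure τ ⊆ Metric.sphere 0 1 := closure_minimal hτ Metric.isClosed_sphere
  have hterm : ∀ p : poles G, poleCoeff G α p / sSup ((fun x => crossNorm x p ^ α) '' closure τ) ≤
      poleCoeff G α p / crossNorm y p ^ α := by
    intro p
    have hp1 : ‖p.1‖ = 1 := by simpa using p.2.2
    have hpos : 0 < crossNorm y p := by
      refine (crossNorm_nonneg _ _).lt_of_ne fun h0 => hyG ?_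
      obtain ⟨R, hR, hR1, hRp⟩ := p.2.1
      obtain ⟨χ, -, h⟩ := exists_stabilizer_character hG hp1
      have := h ⟨R, hR, hRp⟩ y
      rw [← h0, mul_zero, norm_eq_zero, sub_eq_zero] at this
      exact ⟨R, hR, hR1, this⟩
    refine div_le_div_of_nonneg_left (poleCoeff_nonneg _ _ _) (by positivity) ?_
    refine le_csSup ⟨1, ?_⟩ ⟨y, hy, rfl⟩
    rintro _ ⟨z, hz, rfl⟩
    refine Real.rpow_le_one (crossNorm_nonneg _ _) ?_ hα.le
    have := crossNorm_le z p
    rwa [hp1, mem_sphere_zero_iff_norm.1 (hcl hz), one_mul] at this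
  rw [potentialBound]
  by_cases hfin : (Function.support fun p : poles G =>
      poleCoeff G α p / sSup ((fun x => crossNorm x p ^ α) '' closure τ)).Finite
  · rw [finsum_eq_sum _ hfin]
    refine le_trans ?_ (sum_poles_le hG hα y S hS hfin.toFinset)
    exact mul_le_mul_of_nonneg_left (Finset.sum_le_sum fun p _ => hterm p) (by positivity)
  -- With infinite support `finsum` is 0 by default, and the inequality still holds.
  · rw [finsum_of_infinite_support hfin, mul_zero]
    exact sum_one_div_nonneg _ _ _

omit hG in
theorem potentialBound_nonneg (τ : Set R3) (α : ℝ) : 0 ≤ potentialBound G τ α := by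
  refine mul_nonneg (by positivity) (finsum_nonneg fun p => ?_)
  refine div_nonneg (poleCoeff_nonneg _ _ _) (Real.sSup_nonneg ?_)
  rintro _ ⟨x, -, rfl⟩
  exact Real.rpow_nonneg (crossNorm_nonneg _ _) _

end Group

/-! ### Finiteness of the symmetry group -/

/-- A symmetry is determined by its permutation of the finite set V because V spans: before scaling
and rotating, each basis vector is a multiple of a sum of two vertices. -/
theorem IsPlatonic.finite_fullGroup {V : Set R3} (hV : IsPlatonic V) : Finite (fullGroup V) := by
  obtain ⟨P, hP, r, hr, g, rfl⟩ := hV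
  have hφ := Real.goldenRatio_pos
  have hspan : ∀ i : Fin 3, ∃ a ∈ P, ∃ b ∈ P, ∃ k : ℝ, k • (a + b) = EuclideanSpace.single i 1 := by
    have htet : ∀ Q : Set R3, tetrahedron ⊆ Q → ∀ i : Fin 3, ∃ a ∈ Q, ∃ b ∈ Q, ∃ k : ℝ,
        k • (a + b) = EuclideanSpace.single i 1 := by
      intro Q hQ i
      fin_cases i
      · refine ⟨!₂[1, 1, 1], hQ ⟨?_, ?_⟩, !₂[1, -1, -1], hQ ⟨?_, ?_⟩, 1 / 2, ?_⟩
        on_goal 5 => ext j; fin_cases j <;> norm_num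
        all_goals simp [Fin.forall_fin_succ]
      · refine ⟨!₂[1, 1, 1], hQ ⟨?_, ?_⟩, !₂[-1, 1, -1], hQ ⟨?_, ?_⟩, 1 / 2, ?_⟩
        on_goal 5 => ext j; fin_cases j <;> norm_num
        all_goals simp [Fin.forall_fin_succ]
      · refine ⟨!₂[1, 1, 1], hQ ⟨?_, ?_⟩, !₂[-1, -1, 1], hQ ⟨?_, ?_⟩, 1 / 2, ?_⟩
        on_goal 5 => ext j; fin_cases j <;> norm_num
        all_goals simp [Fin.forall_fin_succ]
    have hcube : tetrahedron ⊆ cube := fun x hx => hx.1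
    rcases hP with rfl | rfl | rfl | rfl | rfl
    · exact htet _ subset_rfl
    · exact htet _ hcube
    · intro i
      refine ⟨EuclideanSpace.single i 1, ?_, EuclideanSpace.single i 1, ?_, 1 / 2, ?_⟩
      · exact ⟨i, by simp, by simp, by simp⟩
      · exact ⟨i, by simp, by simp, by simp⟩
      · rw [← two_smul ℝ, smul_smul]; norm_num
    · intro i
      set φ := Real.goldenRatio
      refine ⟨EuclideanSpace.single i 1 + EuclideanSpace.single (i + 1) φ, ⟨i + 2, ?_, ?_, ?_⟩,
        EuclideanSpace.single i 1 - EuclideanSpace.single (i + 1) φ, ⟨i + 2, ?_, ?_, ?_⟩, 1 / 2, ?_⟩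
      on_goal 7 => rw [add_add_sub_cancel, ← two_smul ℝ, smul_smul]; norm_num
      all_goals fin_cases i <;> simp [abs_of_pos hφ, φ]
    · exact htet _ (hcube.trans subset_union_left)
  have hfinP : P.Finite := by
    set φ := Real.goldenRatio
    set C : Set ℝ := {0, 1, -1, φ, -φ, φ⁻¹, -φ⁻¹} with hC
    have hCf : C.Finite := by simp [hC]
    have hpi : (WithLp.ofLp ⁻¹' (Set.univ.pi fun _ : Fin 3 => C) : Set R3).Finite :=
      (Set.Finite.pi' fun _ => hCf).preimage (WithLp.ofLp_injective 2).injOn |>.subset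
        fun x hx i => hx i trivial
    have habs : ∀ {a b : ℝ}, |a| = b → b = 1 ∨ b = φ ∨ b = φ⁻¹ → a ∈ C := by
      intro a b h hb
      rcases eq_or_eq_neg_of_abs_eq h with rfl | rfl <;>
        rcases hb with h' | h' | h' <;> simp [hC, h']
    have hall : ∀ (x : R3) (i : Fin 3), x i ∈ C → x (i + 1) ∈ C → x (i + 2) ∈ C → ∀ j, x j ∈ C := by
      intro x i h0 h1 h2 j
      fin_cases i <;> fin_cases j <;> first | exact h0 | exact h1 | exact h2
    have h0C : ∀ {a : ℝ}, a = 0 → a ∈ C := fun h => by simp [hC, h]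
    have hcube : cube ⊆ (WithLp.ofLp ⁻¹' (Set.univ.pi fun _ : Fin 3 => C) : Set R3) :=
      fun x hx i _ => habs (hx i) (Or.inl rfl)
    refine hpi.subset ?_
    rcases hP with rfl | rfl | rfl | rfl | rfl
    · exact fun x hx => hcube hx.1
    · exact hcube
    · rintro x ⟨i, h0, h1, h2⟩ j _
      exact hall x i (habs h0 (Or.inl rfl)) (h0C h1) (h0C h2) j
    · rintro x ⟨i, h0, h1, h2⟩ j _
      exact hall x i (h0C h0) (habs h1 (Or.inl rfl)) (habs h2 (Or.inr (Or.inl rfl))) j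
    · rintro x (hx | ⟨i, h0, h1, h2⟩)
      · exact hcube hx
      · exact fun j _ => hall x i (h0C h0) (habs h1 (Or.inr (Or.inr rfl)))
          (habs h2 (Or.inr (Or.inl rfl))) j
  set V := (fun x => r • g x) '' P with hVdef
  have hfinV : V.Finite := hfinP.image _
  have : Finite V := hfinV
  let f : fullGroup V → V → V := fun h x => ⟨h.1 x.1, by
    have h2 : h.1 '' V = V := h.2
    exact h2.subset (mem_image_of_mem _ x.2)⟩
  refine Finite.of_injective f fun h h' hh => ?_
  have hV : ∀ x ∈ P, h.1 (g x) = h'.1 (g x) := by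
    intro x hx
    have := congrArg Subtype.val (congrFun hh ⟨r • g x, mem_image_of_mem _ hx⟩)
    simp only [f, map_smul] at this
    exact smul_right_injective R3 hr.ne' this
  ext1
  have hlin : (h.1.toLinearEquiv : R3 →ₗ[ℝ] R3) ∘ₗ (g.toLinearEquiv : R3 →ₗ[ℝ] R3) =
      (h'.1.toLinearEquiv : R3 →ₗ[ℝ] R3) ∘ₗ (g.toLinearEquiv : R3 →ₗ[ℝ] R3) := by
    refine (EuclideanSpace.basisFun (Fin 3) ℝ).toBasis.ext fun i => ?_
    obtain ⟨a, ha, b, hb, k, hk⟩ := hspan i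
    simp only [OrthonormalBasis.coe_toBasis, EuclideanSpace.basisFun_apply, ← hk]
    change h.1 (g (k • (a + b))) = h'.1 (g (k • (a + b)))
    simp only [map_smul, map_add, hV a ha, hV b hb]
  ext1 x
  have := LinearMap.congr_fun hlin (g.symm x)
  change h.1 (g (g.symm x)) = h'.1 (g (g.symm x)) at this
  rwa [g.apply_symm_apply] at this

theorem finite_rotationGroup {V : Set R3} [Finite (fullGroup V)] : Finite (rotationGroup V) :=
  Finite.of_injective (fun R => (⟨R.1, R.2.1⟩ : fullGroup V)) fun R R' h => by
    ext1; exact congrArg (fun z : fullGroup V => z.1) h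

theorem conj_mem_rotationGroup {V : Set R3} {g R : R3 ≃ₗᵢ[ℝ] R3} (hg : g ∈ fullGroup V)
    (hR : R ∈ rotationGroup V) : g⁻¹ * R * g ∈ rotationGroup V := by
  refine ⟨mul_mem (mul_mem (inv_mem hg) hR.1) hg, ?_⟩
  have h : ((g⁻¹ * R * g).toLinearEquiv : R3 →ₗ[ℝ] R3) = (g.symm.toLinearEquiv : R3 →ₗ[ℝ] R3) ∘ₗ
      (R.toLinearEquiv : R3 →ₗ[ℝ] R3) ∘ₗ (g.toLinearEquiv : R3 →ₗ[ℝ] R3) := rfl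
  have h2 : (g.symm.toLinearEquiv : R3 →ₗ[ℝ] R3) ∘ₗ (g.toLinearEquiv : R3 →ₗ[ℝ] R3) =
      LinearMap.id := by
    ext1 x; exact g.symm_apply_apply x
  have h3 := congrArg LinearMap.det h2
  rw [LinearMap.det_comp, LinearMap.det_id] at h3
  rw [h, LinearMap.det_comp, LinearMap.det_comp, hR.2, one_mul, h3]

/-! ### The tessellation -/

/-- Every point of the sphere is moved into the closure of a given triangle. -/
theorem exists_apply_mem_closure {G : Subgroup (R3 ≃ₗᵢ[ℝ] R3)} [Finite G] {τ : Set R3}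
    (hτ : τ ∈ tessellation G) {x : R3} (hx : ‖x‖ = 1) : ∃ g ∈ G, g x ∈ closure τ := by
  obtain ⟨x₀, ⟨hx₀, hx₀m⟩, rfl⟩ := hτ
  have hx₀1 : ‖x₀‖ = 1 := by simpa using hx₀
  -- Take the point of the orbit nearest x₀. Reflecting it cannot bring it nearer, so it lies on the
  -- same closed side of every mirror as x₀.
  obtain ⟨g, hg⟩ := Finite.exists_max fun g : G => (inner ℝ x₀ (g.1 x) : ℝ)
  refine ⟨g.1, g.2, ?_⟩
  set y := g.1 x with hy
  have hy1 : ‖y‖ = 1 := by rw [hy, g.1.norm_map, hx]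
  have hsign : ∀ n : R3, n ≠ 0 → (Submodule.span ℝ {n})ᗮ.reflection ∈ G →
      0 ≤ inner ℝ n x₀ * (inner ℝ n y : ℝ) := by
    intro n hn hnG
    have h1 := hg (⟨_, hnG⟩ * g)
    have e : (⟨(Submodule.span ℝ {n})ᗮ.reflection, hnG⟩ * g : G).1 x =
        (Submodule.span ℝ {n})ᗮ.reflection y := rfl
    rw [e, Submodule.reflection_orthogonal_apply, Submodule.reflection_singleton_apply] at h1
    have hn2 : 0 < ‖n‖ ^ 2 := by positivity
    rw [inner_neg_right, inner_sub_right, two_smul, inner_add_right, inner_smul_right,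
      real_inner_comm n x₀] at h1
    have h2 : 0 ≤ 2 * (inner ℝ n y / ‖n‖ ^ 2 * inner ℝ n x₀ : ℝ) := by
      simp only [RCLike.ofReal_real_eq_id, id] at h1
      linarith
    have h3 : inner ℝ n x₀ * inner ℝ n y = (2 * (inner ℝ n y / ‖n‖ ^ 2 * inner ℝ n x₀)) *
        (‖n‖ ^ 2 / 2) := by field_simp
    rw [h3]
    positivity
  set s : ℝ → R3 := fun t => (1 - t) • x₀ + t • y with hs
  have hsn : ∀ t ∈ Ico (0 : ℝ) 1, ∀ n : R3, n ≠ 0 → (Submodule.span ℝ {n})ᗮ.reflection ∈ G →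
      inner ℝ n (s t) ≠ (0 : ℝ) := by
    intro t ht n hn hnG h0
    have h1 := hsign n hn hnG
    have h2 : inner ℝ n x₀ ≠ (0 : ℝ) := fun h => hx₀m ⟨n, hn, hnG, h⟩
    have h3 : (1 - t) * inner ℝ n x₀ + t * inner ℝ n y = (0 : ℝ) := by
      rw [← h0, hs]; simp [inner_add_right, inner_smul_right]
    have h4 : 0 < (1 - t) * (inner ℝ n x₀ : ℝ) ^ 2 :=
      mul_pos (by linarith [ht.2]) (by positivity)
    have h5 := mul_nonneg ht.1 h1
    have h6 : (1 - t) * (inner ℝ n x₀ : ℝ) ^ 2 + t * (inner ℝ n x₀ * inner ℝ n y) =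
        inner ℝ n x₀ * ((1 - t) * inner ℝ n x₀ + t * inner ℝ n y) := by ring
    rw [h3, mul_zero] at h6
    linarith
  have hs0 : s 0 = x₀ := by simp [hs]
  have hs1 : s 1 = y := by simp [hs]
  -- A mirror keeps the segment from x₀ to y away from 0, so it can be projected to the sphere;
  -- without mirrors the component is the whole sphere.
  by_cases hm : ∃ n : R3, n ≠ 0 ∧ (Submodule.span ℝ {n})ᗮ.reflection ∈ G
  · obtain ⟨n, hn, hnG⟩ := hm
    have hne : ∀ t ∈ Icc (0 : ℝ) 1, s t ≠ 0 := by
      intro t ht h0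
      rcases ht.2.lt_or_eq with h | rfl
      · exact hsn t ⟨ht.1, h⟩ n hn hnG (by rw [h0, inner_zero_right])
      · rw [hs1] at h0; simp [h0] at hy1
    have hsc : Continuous s := by rw [hs]; fun_prop
    have hw : ContinuousOn (fun t => ‖s t‖⁻¹ • s t) (Icc (0 : ℝ) 1) :=
      (hsc.norm.continuousOn.inv₀ fun t ht => norm_ne_zero_iff.2 (hne t ht)).smul hsc.continuousOn
    have hsub : (fun t => ‖s t‖⁻¹ • s t) '' Ico (0 : ℝ) 1 ⊆
        connectedComponentIn (Metric.sphere (0 : R3) 1 \ mirrors G) x₀ := by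
      refine (isPreconnected_Ico.image _
        (hw.mono Ico_subset_Icc_self)).subset_connectedComponentIn
        ⟨0, by simp, by simp [hs0, hx₀1]⟩ ?_
      rintro _ ⟨t, ht, rfl⟩
      have ht0 := norm_ne_zero_iff.2 (hne t (Ico_subset_Icc_self ht))
      refine ⟨by simp [norm_smul, ht0], ?_⟩
      rintro ⟨k, hk, hkG, hk0⟩
      rw [inner_smul_right] at hk0
      exact (mul_ne_zero (inv_ne_zero ht0) (hsn t ht k hk hkG)) hk0
    refine closure_mono hsub ?_
    have hcl : closure (Ico (0 : ℝ) 1) = Icc 0 1 := closure_Ico zero_ne_one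
    refine ContinuousOn.image_closure (hcl ▸ hw) ⟨1, by rw [hcl]; simp, ?_⟩
    simp [hs1, hy1]
  · have he : mirrors G = ∅ := by
      ext z
      simp only [mirrors, mem_empty_iff_false, iff_false]
      rintro ⟨n, hn, hnG, -⟩
      exact hm ⟨n, hn, hnG⟩
    have hrank : 1 < Module.rank ℝ R3 := by
      rw [← Module.finrank_eq_rank, finrank_euclideanSpace_fin]
      norm_num
    have hc := (isPreconnected_sphere hrank (0 : R3) 1).subset_connectedComponentIn hx₀ subset_rfl
    rw [he, sdiff_empty]
    exact subset_closure (hc (by simpa using hy1))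

/-! ### The potential -/

theorem zero_mem_collisionSet {G : Subgroup (R3 ≃ₗᵢ[ℝ] R3)} {R : R3 ≃ₗᵢ[ℝ] R3} (hR : R ∈ G)
    (h1 : R ≠ 1) : (0 : R3) ∈ collisionSet G := ⟨R, hR, h1, map_zero R⟩

theorem potentialBound_eq_zero {G : Subgroup (R3 ≃ₗᵢ[ℝ] R3)} (h : (0 : R3) ∉ collisionSet G)
    (τ : Set R3) (α : ℝ) : potentialBound G τ α = 0 := by
  have : IsEmpty (poles G) :=
    ⟨fun p => by obtain ⟨R, hR, hR1, -⟩ := p.2.1; exact h (zero_mem_collisionSet hR hR1)⟩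
  rw [potentialBound, finsum_of_isEmpty, mul_zero]

theorem ofReal_sum_le_tsum {G : Subgroup (R3 ≃ₗᵢ[ℝ] R3)} {α : ℝ} (hα : 0 < α) {x : R3}
    (hx : x ∉ collisionSet G) (S : Finset (R3 ≃ₗᵢ[ℝ] R3)) (hS : ∀ R, R ∈ S ↔ R ∈ G) :
    ENNReal.ofReal (∑ R ∈ S, 1 / ‖R x - x‖ ^ α) ≤
      ∑' R : {R : R3 ≃ₗᵢ[ℝ] R3 // R ∈ G ∧ R ≠ 1}, 1 / ‖R.1 x - x‖ₑ ^ α := by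
  rw [ENNReal.ofReal_sum_of_nonneg fun R _ => by positivity]
  have h := tsum_subtype (f := fun R : R3 ≃ₗᵢ[ℝ] R3 => 1 / ‖R x - x‖ₑ ^ α) {R | R ∈ G ∧ R ≠ 1}
  refine le_trans ?_ h.ge
  refine (Finset.sum_le_sum fun R hR => ?_).trans (ENNReal.sum_le_tsum S)
  by_cases hR1 : R = 1
  · subst hR1
    simp [Real.zero_rpow hα.ne']
  · have hRG := (hS R).1 hR
    rw [indicator_of_mem (show R ∈ {R | R ∈ G ∧ R ≠ 1} from ⟨hRG, hR1⟩)]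
    have hpos : 0 < ‖R x - x‖ := norm_pos_iff.2 fun h0 => hx ⟨R, hRG, hR1, sub_eq_zero.1 h0⟩
    rw [ENNReal.ofReal_div_of_pos (by positivity), ENNReal.ofReal_one,
      ← ENNReal.ofReal_rpow_of_pos hpos, ofReal_norm]

/-- Both sides are homogeneous of degree -α, and conjugation by the full group permutes the
rotations, so it suffices to test a point of the closed triangle. On a rotation axis the right side
is infinite. -/
theorem potential_ge {V : Set R3} [Finite (fullGroup V)] {α : ℝ} (hα : 0 < α) {τ : Set R3}
    (hτ : τ ∈ tessellation (fullGroup V)) (x : R3) :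
    ENNReal.ofReal (potentialBound (rotationGroup V) τ α / 2) / ‖x‖ₑ ^ α ≤
      1 / 2 * ∑' R : {R : R3 ≃ₗᵢ[ℝ] R3 // R ∈ rotationGroup V ∧ R ≠ 1},
        1 / ‖R.1 x - x‖ₑ ^ α := by
  classical
  have : Finite (rotationGroup V) := finite_rotationGroup
  by_cases hx : x ∈ collisionSet (rotationGroup V)
  · obtain ⟨R, hR, hR1, hRx⟩ := hx
    have h1 : ∑' R : {R : R3 ≃ₗᵢ[ℝ] R3 // R ∈ rotationGroup V ∧ R ≠ 1},
        1 / ‖R.1 x - x‖ₑ ^ α = ⊤ := by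
      refine ENNReal.tsum_eq_top_of_eq_top ⟨⟨R, hR, hR1⟩, ?_⟩
      simp [hRx, ENNReal.zero_rpow_of_pos hα]
    rw [h1, ENNReal.mul_top (by simp)]
    exact le_top
  rcases eq_or_ne x 0 with rfl | hx0
  · rw [potentialBound_eq_zero hx]
    simp
  have hn : 0 < ‖x‖ := norm_pos_iff.2 hx0
  have hfin : {R : R3 ≃ₗᵢ[ℝ] R3 | R ∈ rotationGroup V}.Finite :=
    Set.toFinite (rotationGroup V : Set (R3 ≃ₗᵢ[ℝ] R3))
  have hS : ∀ R, R ∈ hfin.toFinset ↔ R ∈ rotationGroup V := fun R => by simp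
  obtain ⟨g, hg, hgx⟩ := exists_apply_mem_closure hτ (x := ‖x‖⁻¹ • x) (by
    rw [norm_smul, norm_inv, norm_norm, inv_mul_cancel₀ hn.ne'])
  have hconj : ∀ R : R3 ≃ₗᵢ[ℝ] R3, R (g (‖x‖⁻¹ • x)) - g (‖x‖⁻¹ • x) =
      ‖x‖⁻¹ • g ((g⁻¹ * R * g) x - x) := by
    intro R
    have e : g ((g⁻¹ * R * g) x) = R (g x) := g.apply_symm_apply _
    rw [map_sub, e, map_smul, map_smul, smul_sub]
  have hy : g (‖x‖⁻¹ • x) ∉ collisionSet (rotationGroup V) := by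
    rintro ⟨R, hR, hR1, hRy⟩
    have h1 := hconj R
    rw [hRy, sub_self] at h1
    have h2 := (smul_eq_zero.1 h1.symm).resolve_left (inv_ne_zero hn.ne')
    rw [map_eq_zero_iff _ g.injective, sub_eq_zero] at h2
    refine hx ⟨_, conj_mem_rotationGroup hg hR, fun h => hR1 ?_, h2⟩
    have e : R = g * (g⁻¹ * R * g) * g⁻¹ := by group
    rw [e, h]
    group
  have hτs : τ ⊆ Metric.sphere 0 1 := by
    obtain ⟨x₀, -, rfl⟩ := hτ
    exact (connectedComponentIn_subset _ _).trans sdiff_subset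
  have hb := potentialBound_le (G := rotationGroup V) (fun R hR => hR.2) hα hτs hgx hy _ hS
  have hsum : ∑ R ∈ hfin.toFinset, 1 / ‖R (g (‖x‖⁻¹ • x)) - g (‖x‖⁻¹ • x)‖ ^ α =
      ‖x‖ ^ α * ∑ R ∈ hfin.toFinset, 1 / ‖R x - x‖ ^ α := by
    rw [Finset.mul_sum]
    refine Finset.sum_bij' (fun R _ => g⁻¹ * R * g) (fun R _ => g * R * g⁻¹) ?_ ?_ ?_ ?_ ?_
    · exact fun R hR => (hS _).2 (conj_mem_rotationGroup hg ((hS _).1 hR))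
    · intro R hR
      have := conj_mem_rotationGroup (inv_mem hg) ((hS _).1 hR)
      rw [inv_inv] at this
      exact (hS _).2 this
    · intro R _; group
    · intro R _; group
    · intro R _
      rw [hconj, norm_smul, g.norm_map, norm_inv, norm_norm,
        Real.mul_rpow (by positivity) (norm_nonneg _), Real.inv_rpow hn.le]
      have : 0 < ‖x‖ ^ α := by positivity
      field_simp
  rw [hsum] at hb
  have hle : potentialBound (rotationGroup V) τ α / 2 / ‖x‖ ^ α ≤
      1 / 2 * ∑ R ∈ hfin.toFinset, 1 / ‖R x - x‖ ^ α := by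
    rw [div_le_iff₀ (by positivity)]
    linarith
  calc _ = ENNReal.ofReal (potentialBound (rotationGroup V) τ α / 2 / ‖x‖ ^ α) := by
        rw [ENNReal.ofReal_div_of_pos (show 0 < ‖x‖ ^ α by positivity),
          ← ENNReal.ofReal_rpow_of_pos hn, ofReal_norm]
    _ ≤ ENNReal.ofReal (1 / 2 * ∑ R ∈ hfin.toFinset, 1 / ‖R x - x‖ ^ α) :=
        ENNReal.ofReal_le_ofReal hle
    _ = 1 / 2 * ENNReal.ofReal (∑ R ∈ hfin.toFinset, 1 / ‖R x - x‖ ^ α) := by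
        rw [ENNReal.ofReal_mul (by norm_num), ENNReal.ofReal_div_of_pos two_pos]
        simp
    _ ≤ _ := mul_le_mul_right (ofReal_sum_le_tsum hα hx _ hS) _

/-! ### Symmetric loops -/

theorem lintegral_Ioc_add_eq {T : ℝ} (hT : 0 < T) {f : ℝ → ℝ≥0∞} (hf : Function.Periodic f T)
    (t s : ℝ) : ∫⁻ x in Ioc t (t + T), f x = ∫⁻ x in Ioc s (s + T), f x := by
  have : VAddInvariantMeasure (AddSubgroup.zmultiples T) ℝ volume :=
    ⟨fun c s _ => measure_preimage_add _ _ _⟩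
  exact (isAddFundamentalDomain_Ioc hT t).setLIntegral_eq (G := AddSubgroup.zmultiples T)
    (isAddFundamentalDomain_Ioc hT s) f hf.map_vadd_zmultiples

/-- The rotation may change along the approximating loops, but equality of norms does not involve it
and passes to L² limits; continuity then gives it at every t. -/
theorem norm_add_eq_of_mem_h1Closure {T S : ℝ} (hT : 0 < T) {K : Set (ℝ → R3)}
    (hK : ∀ w ∈ K, IsH1Loop T w ∧ ∀ t, ‖w (t + S)‖ = ‖w t‖) {u : ℝ → R3} (hu : u ∈ h1Closure T K)
    (t : ℝ) : ‖u (t + S)‖ = ‖u t‖ := by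
  have huc := (hu.1.isACPath hT).continuous
  set F : ℝ → ℝ≥0∞ := fun t => ‖‖u (t + S)‖ - ‖u t‖‖ₑ ^ 2 with hF
  have hFc : Continuous F := by
    have : Continuous fun t => ‖u (t + S)‖ - ‖u t‖ := by fun_prop
    exact (ENNReal.continuous_pow 2).comp this.enorm
  have hFp : Function.Periodic F T := fun t => by
    simp only [hF]
    rw [add_right_comm, hu.1.1, hu.1.1]
  have hzero : ∫⁻ t in Ioc 0 T, F t = 0 := by
    refine le_antisymm (ENNReal.le_of_forall_pos_le_add fun ε hε _ => ?_) zero_le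
    rw [zero_add]
    obtain ⟨w, hw, hd⟩ := hu.2 (ε / 4) (ENNReal.div_pos (by simpa using hε.ne') (by simp))
    obtain ⟨hwH, hwn⟩ := hK w hw
    have hwc := (hwH.isACPath hT).continuous
    set D : ℝ → ℝ≥0∞ := fun t => ‖u t - w t‖ₑ ^ 2 with hD
    have hDc : Continuous D := (ENNReal.continuous_pow 2).comp (huc.sub hwc).enorm
    have hDp : Function.Periodic D T := fun t => by simp only [hD]; rw [hu.1.1, hwH.1]
    have hDi : ∫⁻ t in Ioc 0 T, D t ≤ ε / 4 :=
      (lintegral_mono fun t => le_self_add).trans hd.le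
    have hDs : ∫⁻ t in Ioc 0 T, D (t + S) = ∫⁻ t in Ioc 0 T, D t := by
      have h1 : ∫⁻ t in Ioc 0 T, D (t + S) = ∫⁻ t in Ioc S (S + T), D t := by
        have := (measurePreserving_add_right volume S).setLIntegral_comp_preimage
          (measurableSet_Ioc (a := S) (b := S + T)) hDc.measurable
        rw [← this]
        congr 2
        ext t
        simp [add_comm S T]
      rw [h1, lintegral_Ioc_add_eq hT hDp S 0, zero_add]
    have hpt : ∀ t, F t ≤ 2 * (D (t + S) + D t) := by
      intro t
      have h1 : |‖u (t + S)‖ - ‖u t‖| ≤ ‖u (t + S) - w (t + S)‖ + ‖u t - w t‖ := by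
        have a1 := abs_norm_sub_norm_le (u (t + S)) (w (t + S))
        have a2 := abs_norm_sub_norm_le (u t) (w t)
        rw [hwn] at a1
        rw [abs_le] at *
        constructor <;> linarith [a1.1, a1.2, a2.1, a2.2]
      simp only [hF, hD, ← ofReal_norm, ← ENNReal.ofReal_pow (norm_nonneg _)]
      have e2 : ∀ r : ℝ, 2 * ENNReal.ofReal r = ENNReal.ofReal (2 * r) := fun r => by
        rw [ENNReal.ofReal_mul two_pos.le, ENNReal.ofReal_ofNat]
      rw [← ENNReal.ofReal_add (by positivity) (by positivity), e2]
      apply ENNReal.ofReal_le_ofReal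
      rw [Real.norm_eq_abs]
      have h2 := pow_le_pow_left₀ (abs_nonneg _) h1 2
      nlinarith [sq_nonneg (‖u (t + S) - w (t + S)‖ - ‖u t - w t‖)]
    calc ∫⁻ t in Ioc 0 T, F t ≤ ∫⁻ t in Ioc 0 T, 2 * (D (t + S) + D t) := lintegral_mono hpt
      _ = 2 * ((∫⁻ t in Ioc 0 T, D (t + S)) + ∫⁻ t in Ioc 0 T, D t) := by
        rw [lintegral_const_mul' _ _ (by simp), lintegral_add_right _ hDc.measurable]
      _ ≤ 2 * (ε / 4 + ε / 4) := by rw [hDs]; gcongr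
      _ = ε := by
        rw [← ENNReal.coe_ofNat, ← ENNReal.coe_ofNat, ← ENNReal.coe_div (by norm_num)]
        norm_cast
        field_simp
        norm_num
  have hFt : F t = 0 := by
    by_contra hne
    have h1 : 0 < ∫⁻ s in Ioc (t - T / 2) (t - T / 2 + T), F s := by
      rw [lintegral_pos_iff_support hFc.measurable]
      have hopen : IsOpen (Function.support F ∩ Ioo (t - T / 2) (t - T / 2 + T)) :=
        hFc.isOpen_support.inter isOpen_Ioo
      have hpos := hopen.measure_pos volume ⟨t, hne, by constructor <;> linarith⟩
      rw [Measure.restrict_apply hFc.isOpen_support.measurableSet]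
      exact hpos.trans_le (measure_mono (inter_subset_inter_right _ Ioo_subset_Ioc_self))
    rw [lintegral_Ioc_add_eq hT hFp _ 0, zero_add, hzero] at h1
    exact lt_irrefl _ h1
  simp only [hF, pow_eq_zero_iff two_ne_zero, enorm_eq_zero, sub_eq_zero] at hFt
  exact hFt

theorem mul_le_lintegral_Ioc {f : ℝ → ℝ≥0∞} {a S : ℝ} (hS : 0 < S) {C : ℝ≥0∞}
    (h : ∀ k : ℕ, C ≤ ∫⁻ t in Ioc (a + k * S) (a + k * S + S), f t) (n : ℕ) :
    n * C ≤ ∫⁻ t in Ioc a (a + n * S), f t := by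
  induction n with
  | zero => simp
  | succ n ih =>
    have e : a + (n + 1 : ℕ) * S = a + n * S + S := by push_cast; ring
    have hu : Ioc a (a + n * S) ∪ Ioc (a + n * S) (a + n * S + S) = Ioc a (a + n * S + S) :=
      Ioc_union_Ioc_eq_Ioc (by have : 0 ≤ n * S := by positivity
                               linarith) (by linarith)
    rw [e, ← hu, lintegral_union measurableSet_Ioc (Ioc_disjoint_Ioc_of_le le_rfl)]
    push_cast
    rw [add_mul, one_mul]
    exact add_le_add ih (h n)

/-- The powers of M combine because 1 - (2-α)/(2+α) = 2α/(2+α). -/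
theorem mul_ejectionAction_div {α μ T : ℝ} (hα : 0 < α) {M : ℕ} (hM : 1 ≤ M) (hT : 0 < T) :
    M * ejectionAction α μ (T / M) =
      (2 + α) / (2 - α) * (1 / 2) * (2 * μ) ^ (2 / (2 + α)) *
        (M * Real.pi / α) ^ (2 * α / (2 + α)) * T ^ ((2 - α) / (2 + α)) := by
  have hM0 : (0 : ℝ) < M := by exact_mod_cast hM
  have hπ := Real.pi_pos
  have e : (M : ℝ) = M ^ (2 * α / (2 + α)) * M ^ ((2 - α) / (2 + α)) := by
    rw [← Real.rpow_add hM0]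
    conv_lhs => rw [← Real.rpow_one (M : ℝ)]
    congr 1
    have : 0 < 2 + α := by linarith
    field_simp
    ring
  have h1 : (0 : ℝ) < M ^ ((2 - α) / (2 + α)) := by positivity
  rw [ejectionAction, Real.div_rpow hT.le hM0.le, mul_div_assoc (M : ℝ),
    Real.mul_rpow hM0.le (by positivity)]
  nth_rewrite 1 [e]
  field_simp

end PlatonicBody

/-! ### The lower bound for the action -/

theorem mainTheorem9 (V : Set PlatonicBody.R3) (hV : PlatonicBody.IsPlatonic V)
    (α : ℝ) (hα : 1 ≤ α ∧ α < 2) (m₀ : ℝ) (hm₀ : 0 ≤ m₀) (T : ℝ) (hT : 0 < T)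
    (M : ℕ) (hM : 1 ≤ M)
    (c : C(AddCircle T,
      {x : PlatonicBody.R3 // x ∉ PlatonicBody.collisionSet (PlatonicBody.rotationGroup V)}))
    (hc : ¬ c.Nullhomotopic)
    (τ : Set PlatonicBody.R3)
    (hτ : τ ∈ PlatonicBody.tessellation (PlatonicBody.fullGroup V))
    (u : ℝ → PlatonicBody.R3)
    (hu : u ∈ PlatonicBody.h1Closure T
      (PlatonicBody.cone (PlatonicBody.rotationGroup V) T M c))
    (hcoll : (M : ℕ∞) ≤ (PlatonicBody.totalCollisions T u).encard) :
    ENNReal.ofReal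
      ((2 + α) / (2 - α) * ((Nat.card (PlatonicBody.rotationGroup V) : ℝ) / 2)
        * (PlatonicBody.potentialBound (PlatonicBody.rotationGroup V) τ α + 2 * m₀)
            ^ (2 / (2 + α))
        * (M * Real.pi / α) ^ (2 * α / (2 + α))
        * T ^ ((2 - α) / (2 + α)))
      ≤ PlatonicBody.action (PlatonicBody.rotationGroup V) α m₀ T u := by
  open PlatonicBody in
  have hfin := hV.finite_fullGroup
  have hα0 : 0 < α := by linarith [hα.1]
  have hB := potentialBound_nonneg (G := rotationGroup V) τ α
  obtain ⟨B, hBdef⟩ : ∃ B, B = potentialBound (rotationGroup V) τ α := ⟨_, rfl⟩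
  rw [← hBdef] at hB ⊢
  set μ : ℝ := m₀ + B / 2 with hμdef
  have h2μ : B + 2 * m₀ = 2 * μ := by rw [hμdef]; ring
  -- If μ = 0 the claimed bound is 0.
  rcases (show 0 ≤ μ by positivity).eq_or_lt with h0 | hμ
  · rw [h2μ, ← h0, mul_zero, Real.zero_rpow (by positivity)]
    simp
  have hM0 : (0 : ℝ) < M := by exact_mod_cast hM
  set S : ℝ := T / M with hS
  have hS0 : 0 < S := by positivity
  have hMS : M * S = T := mul_div_cancel₀ _ hM0.ne'
  have hac := hu.1.isACPath hT
  have hper : ∀ t, ‖u (t + S)‖ = ‖u t‖ := by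
    refine norm_add_eq_of_mem_h1Closure hT (fun w hw => ⟨hw.1, fun t => ?_⟩) hu
    obtain ⟨R, -, hR⟩ := hw.2.2
    rw [hR, R.norm_map]
  obtain ⟨t₀, -, ht₀⟩ : (totalCollisions T u).Nonempty := by
    rw [← Set.encard_pos]
    exact lt_of_lt_of_le (by exact_mod_cast hM) hcoll
  have hzero : ∀ k : ℕ, u (t₀ + k * S) = 0 := by
    intro k
    induction k with
    | zero => simpa using ht₀
    | succ k ih =>
      rw [← norm_eq_zero] at ih ⊢
      rw [show t₀ + (k + 1 : ℕ) * S = t₀ + k * S + S by push_cast; ring, hper, ih]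
  set f : ℝ → ENNReal := fun t => ‖deriv u t‖ₑ ^ 2 / 2 + ENNReal.ofReal μ / ‖u t‖ₑ ^ α with hf
  have hfper : Function.Periodic f T := by
    intro t
    have h1 : deriv u (t + T) = deriv u t := by
      rw [← deriv_comp_add_const, show (fun s => u (s + T)) = u from funext hu.1.1]
    simp only [hf, h1, hu.1.1 t]
  have hint : (M : ENNReal) * ENNReal.ofReal (ejectionAction α μ S) ≤
      ∫⁻ t in Set.Ioc 0 T, f t := by
    have h1 := mul_le_lintegral_Ioc (f := f) (a := t₀) hS0 (fun k => by
      have h2 := hac.ejectionAction_le_lintegral hα.1 hα.2 hμ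
        (show t₀ + k * S < t₀ + k * S + S by linarith) (hzero k) (by
          have := hzero (k + 1)
          rwa [show t₀ + (k + 1 : ℕ) * S = t₀ + k * S + S by push_cast; ring] at this)
      rwa [add_sub_cancel_left] at h2) M
    -- The M arcs tile (t₀, t₀ + T], which periodicity moves to (0, T].
    rw [hMS] at h1
    rwa [lintegral_Ioc_add_eq hT hfper t₀ 0, zero_add] at h1
  have hpt : ∀ t, f t ≤ ‖deriv u t‖ₑ ^ 2 / 2 + ENNReal.ofReal m₀ / ‖u t‖ₑ ^ α +
      1 / 2 * ∑' R : {R : R3 ≃ₗᵢ[ℝ] R3 // R ∈ rotationGroup V ∧ R ≠ 1},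
        1 / ‖R.1 (u t) - u t‖ₑ ^ α := by
    intro t
    have h1 := potential_ge hα0 hτ (u t)
    rw [← hBdef] at h1
    simp only [hf]
    rw [hμdef, ENNReal.ofReal_add hm₀ (by positivity), ENNReal.add_div, ← add_assoc]
    exact add_le_add_right h1 _
  have hval : (2 + α) / (2 - α) * ((Nat.card (rotationGroup V) : ℝ) / 2) *
      (B + 2 * m₀) ^ (2 / (2 + α)) * (M * Real.pi / α) ^ (2 * α / (2 + α)) *
      T ^ ((2 - α) / (2 + α)) = Nat.card (rotationGroup V) * (M * ejectionAction α μ S) := by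
    rw [mul_ejectionAction_div hα0 hM hT, h2μ]
    ring
  rw [hval, ENNReal.ofReal_mul (by positivity), ENNReal.ofReal_mul (by positivity),
    ENNReal.ofReal_natCast, ENNReal.ofReal_natCast]
  exact mul_le_mul_right (hint.trans (lintegral_mono hpt)) _
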